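/- **Lemma (existence of global interpolant).** Let $p\ge 1$. There is a constant $C>0$, depending only on $p$, such that the following holds. Let $0<\gamma<1$, $\Omega=(0,1)$, $\Omega_0=(0,\gamma)$, $\Omega_1=(\gamma,1)$, let $0=x_0<x_1<\dots<x_N=1$ be a mesh with elements $\tau_l=[x_{l-1},x_l]$, $1\le l\le N$, and mesh size $h=\max_l (x_l-x_{l-1})$, none of whose nodes equals $\gamma$, and let $\tau_r$ be the element containing $\gamma$. Let $N_j^p$, $0\le j\le pN$, be the $C^0$ B-spline basis of degree $p$ on this mesh (on $\tau_l$, with local coordinate $t=(x-x_{l-1})/(x_l-x_{l-1})$, the function $N_{p(l-1)+k}^p$ equals $\binom pk t^k(1-t)^{p-k}$ for $0\le k\le p$, and all other $N_j^p$ vanish). Let $w=\mathcal I_h w^*-w^*$, where $w^*(x)=|x-\gamma|$ and $\mathcal I_h$ is continuous piecewise linear interpolation at the nodes of the mesh. Let the $p$-th order SGFEM space be $$V^h=\operatorname{span}\{N_j^p:\ 1\le j\le pN-1\}+\operatorname{span}\{w\,N_j^p:\ p(r-1)\le j\le pr\}.$$ Let $u\in C^0([0,1])$ satisfy $u(0)=u(1)=0$,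 $u|_{\Omega_0}\in H^{p+1}(\Omega_0)$ and $u|_{\Omega_1}\in H^{p+1}(\Omega_1)$. Then there is $u_h^*\in V^h$ such that $$\|u-u_h^*\|_{L^2(\Omega)}\le C h^{p+1}\big(|u|_{H^{p+1}(\Omega_0)}+|u|_{H^{p+1}(\Omega_1)}\big),\qquad |u-u_h^*|_{H^1(\Omega)}\le C h^{p}\big(|u|_{H^{p+1}(\Omega_0)}+|u|_{H^{p+1}(\Omega_1)}\big).$$ Moreover, $u_h^*$ can be taken to be the piecewise Lagrange interpolant of $u$ on each side of the interface: on each of the intervals $\tau_l$ ($l\ne r$), $[x_{r-1},\gamma]$ and $[\gamma,x_r]$ it is the polynomial of degree at most $p$ that agrees with $u$ at the $p+1$ equally spaced points of that interval, end points included. -/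

import Mathlib

open MeasureTheory Polynomial
open scoped ENNReal ContDiff

noncomputable section

namespace SGFEM

/-! ### Sobolev spaces on open subsets of the line, through weak derivatives -/

/-- `g` is a weak derivative of order `k` of `u` on the open set `U`. -/
def HasWeakDeriv (U : Set ℝ) (k : ℕ) (u g : ℝ → ℝ) : Prop :=
  LocallyIntegrableOn u U ∧ LocallyIntegrableOn g U ∧
    ∀ φ : ℝ → ℝ, ContDiff ℝ ∞ φ → HasCompactSupport φ → tsupport φ ⊆ U →
      ∫ x in U, u x * iteratedDeriv k φ x = (-1 : ℝ) ^ k * ∫ x in U, g x * φ x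

/-- Membership of `u` in `H^k(U)`: all weak derivatives of order at most `k` (the function itself
included) exist and belong to `L²(U)`. -/
def MemH (k : ℕ) (U : Set ℝ) (u : ℝ → ℝ) : Prop :=
  ∀ i ≤ k, ∃ g : ℝ → ℝ, HasWeakDeriv U i u g ∧ MemLp g 2 (volume.restrict U)

/-- The seminorm `|u|_{H^k(U)}`, the `L²(U)` norm of the weak derivative of order `k`. That
derivative is unique up to null sets, so the infimum is over equal numbers; the value is `∞` if
there is no weak derivative of order `k`. -/
def hSeminorm (k : ℕ) (U : Set ℝ) (u : ℝ → ℝ) : ℝ≥0∞ :=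
  ⨅ (g : ℝ → ℝ) (_ : HasWeakDeriv U k u g), eLpNorm g 2 (volume.restrict U)

/-! ### Meshes and finite element spaces -/

/-- A partition `0 = x_0 < x_1 < ⋯ < x_N = 1` of the unit interval (in particular `N ≥ 1`). -/
structure Mesh (N : ℕ) where
  node : Fin (N + 1) → ℝ
  strictMono_node : StrictMono node
  node_zero : node 0 = 0
  node_last : node (Fin.last N) = 1

namespace Mesh

variable {N : ℕ}

/-- Left endpoint of the element number `l`; elements are numbered `0, …, N - 1`. -/
def left (m : Mesh N) (l : Fin N) : ℝ := m.node l.castSucc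

/-- Right endpoint of the element number `l`. -/
def right (m : Mesh N) (l : Fin N) : ℝ := m.node l.succ

/-- The mesh size `h`, the largest length of an element. -/
def size (m : Mesh N) : ℝ := ⨆ l : Fin N, (m.right l - m.left l)

/-- Half-open elements (the last one closed), which partition `[0, 1]`. -/
def cell (m : Mesh N) (l : Fin N) : Set ℝ :=
  {x | m.left l ≤ x ∧ (x < m.right l ∨ ((l : ℕ) + 1 = N ∧ x = m.right l))}

/-- The `C⁰` B-spline `N_j^p` of degree `p`, `0 ≤ j ≤ p N` (each interior mesh node is a knot of
multiplicity `p`, the end points have multiplicity `p + 1`). On the element number `l` it is the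
Bernstein polynomial number `j - p l` of degree `p` in the local coordinate if
`p l ≤ j ≤ p l + p`, and zero otherwise. It is extended by zero outside `[0, 1]`.
(`bernsteinPolynomial ℝ p k` is zero for `k > p`.) -/
def bspline (m : Mesh N) (p j : ℕ) (x : ℝ) : ℝ :=
  ∑ l : Fin N, (m.cell l).indicator
    (fun y => if p * (l : ℕ) ≤ j then
      (bernsteinPolynomial ℝ p (j - p * (l : ℕ))).eval
        ((y - m.left l) / (m.right l - m.left l))
      else 0) x

/-- The standard finite element space, spanned by `N_j^p` for `1 ≤ j ≤ p N - 1`. -/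
def femSpace (m : Mesh N) (p : ℕ) : Submodule ℝ (ℝ → ℝ) :=
  Submodule.span ℝ {f | ∃ j : ℕ, 0 < j ∧ j < p * N ∧ f = m.bspline p j}

/-- The continuous piecewise linear interpolant of `g` on the mesh. -/
def linearInterp (m : Mesh N) (g : ℝ → ℝ) (x : ℝ) : ℝ :=
  ∑ i : Fin (N + 1), g (m.node i) * m.bspline 1 (i : ℕ) x

/-- The enrichment function `w = I_h w* - w*` on `[0, 1]`, where `w*(x) = |x - γ|`. -/
def enrichment (m : Mesh N) (γ x : ℝ) : ℝ :=
  m.linearInterp (fun y => |y - γ|) x - |x - γ|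

/-- Indices of the enriched basis functions: the `p + 1` indices `p r, …, p r + p` of the basis
functions that do not vanish on the element number `r` that contains `γ`. -/
def enrichedIndices (m : Mesh N) (p : ℕ) (γ : ℝ) : Set ℕ :=
  {j | ∃ r : Fin N, γ ∈ Set.Icc (m.left r) (m.right r) ∧
    p * (r : ℕ) ≤ j ∧ j ≤ p * (r : ℕ) + p}

/-- The enrichment space, spanned by the products `w N_j^p` over the enriched indices `j`. -/
def enrSpace (m : Mesh N) (p : ℕ) (γ : ℝ) : Submodule ℝ (ℝ → ℝ) :=
  Submodule.span ℝ
    {f | ∃ j ∈ m.enrichedIndices p γ, f = fun x => m.enrichment γ x * m.bspline p j x}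

/-- The `p`-th order SGFEM space `V^h`, the sum of the two spaces above. -/
def sgfemSpace (m : Mesh N) (p : ℕ) (γ : ℝ) : Submodule ℝ (ℝ → ℝ) :=
  m.femSpace p ⊔ m.enrSpace p γ

end Mesh

/-! ### The piecewise Lagrange interpolant -/

/-- On `[a, b]`, `v` is the Lagrange interpolation polynomial of degree at most `p` of `u` at the
equally spaced points `a + (k / p) (b - a)`, `k = 0, …, p`. -/
def IsLagrangeInterpOn (p : ℕ) (a b : ℝ) (u v : ℝ → ℝ) : Prop :=
  ∀ x ∈ Set.Icc a b, v x =
    (Lagrange.interpolate (Finset.range (p + 1))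
      (fun k : ℕ => a + (k : ℝ) / (p : ℝ) * (b - a))
      (fun k : ℕ => u (a + (k : ℝ) / (p : ℝ) * (b - a)))).eval x

/-- `v` is, on each side of the interface `γ`, the piecewise Lagrange interpolant of `u`: on each
element that does not contain `γ`, and on both parts into which `γ` divides its element. -/
def IsInterfaceInterp {N : ℕ} (m : Mesh N) (p : ℕ) (γ : ℝ) (u v : ℝ → ℝ) : Prop :=
  ∀ l : Fin N,
    (γ ∉ Set.Icc (m.left l) (m.right l) → IsLagrangeInterpOn p (m.left l) (m.right l) u v) ∧
    (γ ∈ Set.Icc (m.left l) (m.right l) →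
      IsLagrangeInterpOn p (m.left l) γ u v ∧ IsLagrangeInterpOn p γ (m.right l) u v)

end SGFEM

end

/-! The interpolant is fixed by its values, so two things need proof: it lies in $V^h$, and its
error has the right order. The constant $C=1$ suffices.

Error. On an interval $(a,b)$ on one side of $\gamma$, a du Bois-Reymond argument shows that $u$ is
the restriction of a $C^p$ function $F$ whose derivative $F^{(p)}$ oscillates by at most
$\int_a^b|g|$, with $g$ the weak derivative of order $p+1$ (`exists_contDiff_of_weakDeriv`).
Subtracting the interpolant leaves this oscillation unchanged and creates $p+1$ zeros. By Rolle
every derivative of the error $E$ up to order $p$ has a zero, so integrating back gives $|E|\le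
(b-a)^p\int|g|$ and $|E'|\le (b-a)^{p-1}\int|g|$ (`exists_contDiff_error`). Cauchy-Schwarz and
integration over $(a,b)$ contribute one further factor $b-a$ in $L^2$. The squared estimates add up
over the mesh. The error vanishes at the ends of each interval, so integration by parts glues
without boundary terms and the piecewise derivative is the weak one (`ErrorBound`).

Membership. Let $V_0,V_1$ be the two interpolants on the element containing $\gamma$, and $w_0,w_1$
the linear branches of $w$. Both $V_0-V_1$ and $w_0-w_1=2(x-\gamma)$ vanish at $\gamma$, so
$V_0-V_1=(w_0-w_1)Q$ with $\deg Q\le p-1$. Hence $R=V_0-w_0Q=V_1-w_1Q$ is one polynomial of degree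
at most $p$ on the whole element, and the interpolant there is $R+wQ$
(`Mesh.exists_interfaceInterp`). -/

namespace SGFEM

/-! ### Test functions and the regularity of functions with a weak derivative -/

/-- Smooth functions with compact support in `U`. -/
structure IsTest (U : Set ℝ) (φ : ℝ → ℝ) : Prop where
  contDiff : ContDiff ℝ ∞ φ
  compact : HasCompactSupport φ
  subset : tsupport φ ⊆ U

namespace IsTest

variable {U : Set ℝ} {φ ψ : ℝ → ℝ}

lemma continuous (h : IsTest U φ) : Continuous φ := h.contDiff.continuous

lemma const_mul (h : IsTest U φ) (c : ℝ) : IsTest U (fun x => c * φ x) where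
  contDiff := contDiff_const.mul h.contDiff
  compact := h.compact.mul_left (f := fun _ => c)
  subset := (tsupport_mul_subset_right (f := fun _ : ℝ => c)).trans h.subset

lemma sub (h : IsTest U φ) (h' : IsTest U ψ) : IsTest U (fun x => φ x - ψ x) where
  contDiff := h.contDiff.sub h'.contDiff
  compact := h.compact.sub h'.compact
  subset := (tsupport_sub φ ψ).trans (Set.union_subset h.subset h'.subset)

lemma continuous_iteratedDeriv (h : IsTest U φ) (k : ℕ) : Continuous (iteratedDeriv k φ) :=
  h.contDiff.continuous_iteratedDeriv k (by exact_mod_cast le_top)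

lemma eq_zero (h : IsTest U φ) {x : ℝ} (hx : x ∉ U) : φ x = 0 :=
  image_eq_zero_of_notMem_tsupport fun hx' => hx (h.subset hx')

/-- The primitive from `a` vanishes to the left of the support of `η`, and to its right equals the
full integral, which is zero. -/
lemma exists_primitive {a b : ℝ} {η : ℝ → ℝ} (h : IsTest (Set.Ioo a b) η)
    (h0 : ∫ x, η x = 0) : ∃ φ, IsTest (Set.Ioo a b) φ ∧ deriv φ = η := by
  have hder : deriv (fun x => ∫ t in a..x, η t) = η := by
    ext x
    exact h.continuous.deriv_integral η a x
  by_cases hne : (tsupport η).Nonempty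
  · have hK : IsCompact (tsupport η) := h.compact
    have hc := h.subset (hK.sInf_mem hne)
    have hd := h.subset (hK.sSup_mem hne)
    set c := sInf (tsupport η)
    set d := sSup (tsupport η)
    have hsub : tsupport η ⊆ Set.Icc c d := fun x hx =>
      ⟨csInf_le hK.bddBelow hx, le_csSup hK.bddAbove hx⟩
    have hsupp : Function.support (fun x => ∫ t in a..x, η t) ⊆ Set.Icc c d := by
      intro x hx
      by_contra hxn
      apply hx
      rcases lt_or_ge x c with hxc | hxc
      · have : ∀ t ∈ Set.uIcc a x, η t = 0 := fun t ht => by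
          apply image_eq_zero_of_notMem_tsupport
          intro ht'
          have h1 := (hsub ht').1
          have h2 : t ≤ max a x := ht.2
          have := max_lt hc.1 hxc
          linarith
        show ∫ t in a..x, η t = 0
        rw [intervalIntegral.integral_congr this]
        simp
      · have hxd : d < x := by
          by_contra hxd
          exact hxn ⟨hxc, not_lt.1 hxd⟩
        show ∫ t in a..x, η t = 0
        rw [intervalIntegral.integral_eq_integral_of_support_subset, h0]
        intro t ht
        have := hsub (subset_tsupport η ht)
        exact ⟨hc.1.trans_le this.1, this.2.trans hxd.le⟩
    have hts : tsupport (fun x => ∫ t in a..x, η t) ⊆ Set.Icc c d :=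
      closure_minimal hsupp isClosed_Icc
    refine ⟨_, ⟨?_, ?_, hts.trans fun x hx => ⟨hc.1.trans_le hx.1, hx.2.trans_lt hd.2⟩⟩, hder⟩
    · rw [contDiff_infty_iff_deriv, hder]
      refine ⟨fun x => ?_, h.contDiff⟩
      exact (intervalIntegral.integral_hasDerivAt_right (h.continuous.intervalIntegrable _ _)
        (h.continuous.stronglyMeasurableAtFilter _ _) h.continuous.continuousAt).differentiableAt
    · exact isCompact_Icc.of_isClosed_subset (isClosed_tsupport _) hts
  · have : η = 0 := tsupport_eq_empty_iff.1 (Set.not_nonempty_iff_eq_empty.1 hne)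
    subst this
    exact ⟨0, h, by ext; simp⟩

lemma integral_eq {a b : ℝ} {η : ℝ → ℝ} (h : IsTest (Set.Ioo a b) η) :
    ∫ x, η x = ∫ x in a..b, η x := by
  rw [intervalIntegral.integral_eq_integral_of_support_subset]
  exact (subset_tsupport η).trans (h.subset.trans Set.Ioo_subset_Ioc_self)

lemma exists_integral_eq_one {a b : ℝ} (hab : a < b) :
    ∃ ψ, IsTest (Set.Ioo a b) ψ ∧ ∫ x, ψ x = 1 := by
  obtain ⟨f, hf1, hf2, hf3, hf4, hf5⟩ := exists_contDiff_tsupport_subset (n := ⊤)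
    (Ioo_mem_nhds (show a < (a + b) / 2 by linarith) (show (a + b) / 2 < b by linarith))
  have hpos : 0 < ∫ x, f x :=
    hf3.continuous.integral_pos_of_hasCompactSupport_nonneg_nonzero hf2
      (fun x => (hf4 ⟨x, rfl⟩).1) (x := (a + b) / 2) (by rw [hf5]; norm_num)
  have hf : IsTest (Set.Ioo a b) f := ⟨hf3, hf2, hf1⟩
  refine ⟨_, hf.const_mul (∫ x, f x)⁻¹, ?_⟩
  rw [integral_const_mul, inv_mul_cancel₀ hpos.ne']

end IsTest

/-! ### Du Bois-Reymond argument for weak derivatives on an interval -/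

lemma integral_primitive_mul_deriv {a b : ℝ} {g φ : ℝ → ℝ}
    (hg : IntervalIntegrable g volume a b) (hφ : ContDiff ℝ 1 φ) (ha : φ a = 0) (hb : φ b = 0) :
    ∫ x in a..b, (∫ t in a..x, g t) * deriv φ x = - ∫ x in a..b, g x * φ x := by
  rw [AbsolutelyContinuousOnInterval.integral_mul_deriv_eq_deriv_mul
    (hg.absolutelyContinuousOnInterval_intervalIntegral Set.left_mem_uIcc)
    (hφ.contDiffOn.absolutelyContinuousOnInterval), ha, hb]
  simp only [mul_zero, sub_zero, zero_sub, neg_inj]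
  apply intervalIntegral.integral_congr_ae
  filter_upwards [hg.ae_hasDerivAt_integral] with x hx hx'
  rw [(hx (Set.uIoc_subset_uIcc hx') a Set.left_mem_uIcc).deriv]

/-- Subtracting from `η` a multiple of a fixed `ψ` of integral one leaves a test function of mean
zero. It is the derivative of a test function, to which `H` applies; integration by parts then moves
the derivative onto the primitive of `g`. -/
lemma exists_weakDeriv_primitive {a b : ℝ} (hab : a < b) {u g : ℝ → ℝ} {k : ℕ}
    (hu : IntervalIntegrable u volume a b) (hg : ∀ x y, IntervalIntegrable g volume x y)
    (H : ∀ φ, IsTest (Set.Ioo a b) φ →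
      ∫ x in a..b, u x * iteratedDeriv (k + 1) φ x = (-1) ^ (k + 1) * ∫ x in a..b, g x * φ x) :
    ∃ c : ℝ, ∀ η, IsTest (Set.Ioo a b) η →
      ∫ x in a..b, u x * iteratedDeriv k η x
        = (-1) ^ k * ∫ x in a..b, (c + ∫ t in a..x, g t) * η x := by
  obtain ⟨ψ, hψ, hψ1⟩ := IsTest.exists_integral_eq_one hab
  have hG : Continuous fun x => ∫ t in a..x, g t := intervalIntegral.continuous_primitive hg a
  -- This constant is forced by the desired identity at `η = ψ`.
  refine ⟨(-1) ^ k * (∫ x in a..b, u x * iteratedDeriv k ψ x) -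
    ∫ x in a..b, (∫ t in a..x, g t) * ψ x, fun η hη => ?_⟩
  set I := ∫ x, η x with hI
  have hζ := hη.sub (hψ.const_mul I)
  have hζ0 : ∫ x, (η x - I * ψ x) = 0 := by
    rw [integral_sub (hη.continuous.integrable_of_hasCompactSupport hη.compact)
      ((hψ.continuous.integrable_of_hasCompactSupport hψ.compact).const_mul I),
      integral_const_mul, hψ1]
    simp [hI]
  obtain ⟨φ, hφ, hd⟩ := hζ.exists_primitive hζ0
  have h1 := H φ hφ
  have hk : iteratedDeriv (k + 1) φ =
      fun x => iteratedDeriv k η x - I * iteratedDeriv k ψ x := by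
    rw [iteratedDeriv_succ', hd]
    ext x
    have h2 : ContDiffAt ℝ k η x := (hη.contDiff.of_le (by exact_mod_cast le_top)).contDiffAt
    have h3 : ContDiffAt ℝ k ψ x := (hψ.contDiff.of_le (by exact_mod_cast le_top)).contDiffAt
    rw [iteratedDeriv_fun_sub h2 (contDiffAt_const.mul h3), iteratedDeriv_const_mul_field]
  have hη0 : ∫ x in a..b, η x = I := (hη.integral_eq).symm
  have h2 := integral_primitive_mul_deriv (hg a b)
    (hφ.contDiff.of_le (by exact_mod_cast le_top))
    (hφ.eq_zero (by simp)) (hφ.eq_zero (by simp))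
  have i1 : IntervalIntegrable (fun x => u x * iteratedDeriv k η x) volume a b :=
    hu.mul_continuousOn (hη.continuous_iteratedDeriv k).continuousOn
  have i2 : IntervalIntegrable (fun x => u x * iteratedDeriv k ψ x) volume a b :=
    hu.mul_continuousOn (hψ.continuous_iteratedDeriv k).continuousOn
  have i3 : IntervalIntegrable (fun x => (∫ t in a..x, g t) * η x) volume a b :=
    (hG.mul hη.continuous).intervalIntegrable _ _
  have i4 : IntervalIntegrable (fun x => (∫ t in a..x, g t) * ψ x) volume a b :=
    (hG.mul hψ.continuous).intervalIntegrable _ _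
  have e1 : ∫ x in a..b, u x * iteratedDeriv (k + 1) φ x =
      (∫ x in a..b, u x * iteratedDeriv k η x) - I * ∫ x in a..b, u x * iteratedDeriv k ψ x := by
    rw [← intervalIntegral.integral_const_mul, ← intervalIntegral.integral_sub i1 (i2.const_mul I),
      hk]
    congr 1; ext x; ring
  have e2 : ∫ x in a..b, (∫ t in a..x, g t) * deriv φ x =
      (∫ x in a..b, (∫ t in a..x, g t) * η x) -
        I * ∫ x in a..b, (∫ t in a..x, g t) * ψ x := by
    rw [← intervalIntegral.integral_const_mul, ← intervalIntegral.integral_sub i3 (i4.const_mul I),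
      hd]
    congr 1; ext x; ring
  have e3 : ∀ c : ℝ, ∫ x in a..b, (c + ∫ t in a..x, g t) * η x =
      c * I + ∫ x in a..b, (∫ t in a..x, g t) * η x := by
    intro c
    rw [← hη0, ← intervalIntegral.integral_const_mul, ← intervalIntegral.integral_add
      ((hη.continuous.intervalIntegrable _ _).const_mul c) i3]
    congr 1; ext x; ring
  rw [e3]
  rw [e1] at h1
  rw [e2] at h2
  have hs : ((-1 : ℝ) ^ k) * (-1) ^ k = 1 := by
    rw [← mul_pow]; norm_num
  have h1' := eq_add_of_sub_eq h1
  rw [h1', pow_succ]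
  have h2' : ∫ x in a..b, g x * φ x = -((∫ x in a..b, (∫ t in a..x, g t) * η x) -
        I * ∫ x in a..b, (∫ t in a..x, g t) * ψ x) := by linarith
  rw [h2']
  linear_combination (-I * ∫ x in a..b, u x * iteratedDeriv k ψ x) * hs

lemma ae_eq_of_forall_isTest {a b : ℝ} (hab : a < b) {u f : ℝ → ℝ}
    (hu : IntervalIntegrable u volume a b) (hf : IntervalIntegrable f volume a b)
    (H : ∀ φ, IsTest (Set.Ioo a b) φ → ∫ x in a..b, u x * φ x = ∫ x in a..b, f x * φ x) :
    ∀ᵐ x, x ∈ Set.Ioo a b → u x = f x := by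
  have hi : IntegrableOn (fun x => u x - f x) (Set.Ioo a b) :=
    ((intervalIntegrable_iff_integrableOn_Ioc_of_le hab.le).1 (hu.sub hf)).mono_set
      Set.Ioo_subset_Ioc_self
  have := isOpen_Ioo.ae_eq_zero_of_integral_contDiff_smul_eq_zero hi.locallyIntegrableOn
    fun φ h1 h2 h3 => by
      have hφ : IsTest (Set.Ioo a b) φ := ⟨h1, h2, h3⟩
      have e : ∫ x, φ x • (u x - f x) = ∫ x in a..b, (u x * φ x - f x * φ x) := by
        rw [intervalIntegral.integral_eq_integral_of_support_subset]
        · congr 1; ext x; simp only [smul_eq_mul]; ring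
        · intro x hx
          by_contra hxn
          apply hx
          have : φ x = 0 := hφ.eq_zero fun h => hxn (Set.Ioo_subset_Ioc_self h)
          simp [this]
      rw [e, intervalIntegral.integral_sub (hu.mul_continuousOn hφ.continuous.continuousOn)
        (hf.mul_continuousOn hφ.continuous.continuousOn), H φ hφ, sub_self]
  filter_upwards [this] with x hx hx'
  linarith [hx hx']

/-- Each induction step replaces `g` by one of its primitives and lowers the order by one; order
zero is the fundamental lemma of the calculus of variations. -/
lemma exists_contDiff_of_weakDeriv_continuous {a b : ℝ} (hab : a < b) {u : ℝ → ℝ}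
    (hu : IntervalIntegrable u volume a b) (k : ℕ) : ∀ g : ℝ → ℝ, Continuous g →
    (∀ φ, IsTest (Set.Ioo a b) φ →
      ∫ x in a..b, u x * iteratedDeriv k φ x = (-1) ^ k * ∫ x in a..b, g x * φ x) →
    ∃ F : ℝ → ℝ, ContDiff ℝ k F ∧ iteratedDeriv k F = g ∧
      ∀ᵐ x, x ∈ Set.Ioo a b → u x = F x := by
  induction k with
  | zero =>
    intro g hg H
    refine ⟨g, by simpa using hg, by simp, ?_⟩
    exact ae_eq_of_forall_isTest hab hu (hg.intervalIntegrable _ _) (by simpa using H)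
  | succ k ih =>
    intro g hg H
    obtain ⟨c, hc⟩ := exists_weakDeriv_primitive hab hu (fun x y => hg.intervalIntegrable x y) H
    have hd : ∀ x, HasDerivAt (fun x => c + ∫ t in a..x, g t) (g x) x := fun x =>
      (intervalIntegral.integral_hasDerivAt_right (hg.intervalIntegrable _ _)
        (hg.stronglyMeasurableAtFilter _ _) hg.continuousAt).const_add c
    obtain ⟨F, h1, h2, h3⟩ := ih _
      (continuous_iff_continuousAt.2 fun x => (hd x).continuousAt) hc
    have h4 : iteratedDeriv (k + 1) F = g := by
      rw [iteratedDeriv_succ, h2]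
      ext x
      exact (hd x).deriv
    refine ⟨F, ?_, h4, h3⟩
    rw [contDiff_nat_iff_iteratedDeriv] at h1 ⊢
    constructor
    · intro m hm
      rcases hm.lt_or_eq with h | rfl
      · exact h1.1 m (by omega)
      · rw [h4]; exact hg
    · intro m hm
      rcases (Nat.lt_succ_iff.1 hm).lt_or_eq with h | rfl
      · exact h1.2 m h
      · rw [h2]; exact fun x => (hd x).differentiableAt

/-- A continuous function with an integrable weak derivative of order `p + 1` is the restriction of
a `C^p` function whose derivative of order `p` is absolutely continuous. -/
lemma exists_contDiff_of_weakDeriv {a b : ℝ} (hab : a < b) {u g : ℝ → ℝ} {p : ℕ}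
    (hu : ContinuousOn u (Set.Icc a b)) (hg : IntegrableOn g (Set.Ioo a b))
    (H : ∀ φ, IsTest (Set.Ioo a b) φ →
      ∫ x in Set.Ioo a b, u x * iteratedDeriv (p + 1) φ x
        = (-1) ^ (p + 1) * ∫ x in Set.Ioo a b, g x * φ x) :
    ∃ F : ℝ → ℝ, ContDiff ℝ p F ∧ Set.EqOn u F (Set.Icc a b) ∧
      ∀ x ∈ Set.Icc a b, ∀ y ∈ Set.Icc a b,
        |iteratedDeriv p F x - iteratedDeriv p F y| ≤ ∫ t in Set.Ioo a b, |g t| := by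
  -- Extension by zero makes the primitive continuous on all of ℝ, as the previous lemma requires.
  set g' := (Set.Ioo a b).indicator g with hg'
  have hgi : Integrable g' := by rwa [hg', integrable_indicator_iff measurableSet_Ioo]
  have hui : IntervalIntegrable u volume a b :=
    ContinuousOn.intervalIntegrable (by rwa [Set.uIcc_of_le hab.le])
  have H' : ∀ φ, IsTest (Set.Ioo a b) φ →
      ∫ x in a..b, u x * iteratedDeriv (p + 1) φ x
        = (-1) ^ (p + 1) * ∫ x in a..b, g' x * φ x := by
    intro φ hφ
    rw [intervalIntegral.integral_of_le hab.le, intervalIntegral.integral_of_le hab.le,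
      integral_Ioc_eq_integral_Ioo, integral_Ioc_eq_integral_Ioo, H φ hφ]
    congr 1
    refine setIntegral_congr_fun measurableSet_Ioo fun x hx => ?_
    simp only [hg', Set.indicator_of_mem hx]
  have hgint : ∀ x y, IntervalIntegrable g' volume x y := fun x y => hgi.intervalIntegrable
  obtain ⟨c, hc⟩ := exists_weakDeriv_primitive hab hui hgint H'
  obtain ⟨F, h1, h2, h3⟩ := exists_contDiff_of_weakDeriv_continuous hab hui p _
    (continuous_const.add (intervalIntegral.continuous_primitive hgint a)) hc
  refine ⟨F, h1, ?_, fun x hx y hy => ?_⟩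
  · have hIoo : Set.EqOn u F (Set.Ioo a b) := by
      refine Measure.eqOn_open_of_ae_eq (μ := volume) ?_ isOpen_Ioo
        (hu.mono Set.Ioo_subset_Icc_self) h1.continuous.continuousOn
      rw [Filter.EventuallyEq, ae_restrict_iff' measurableSet_Ioo]
      exact h3
    exact hIoo.of_subset_closure hu h1.continuous.continuousOn Set.Ioo_subset_Icc_self
      (by rw [closure_Ioo hab.ne])
  · rw [h2]
    simp only [Pi.add_apply]
    rw [add_sub_add_left_eq_sub, intervalIntegral.integral_interval_sub_left (hgint _ _)
      (hgint _ _)]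
    calc |∫ t in y..x, g' t| ≤ ∫ t in Set.uIoc y x, |g' t| :=
          intervalIntegral.norm_integral_le_integral_norm_uIoc (f := g')
      _ ≤ ∫ t, |g' t| := setIntegral_le_integral hgi.abs (.of_forall fun t => abs_nonneg _)
      _ = ∫ t in Set.Ioo a b, |g t| := by
          rw [← integral_indicator measurableSet_Ioo]
          congr 1; ext t
          by_cases ht : t ∈ Set.Ioo a b <;> simp [hg', ht]

/-! ### The interpolation error on one interval -/

lemma exists_zeros_deriv {a b : ℝ} {n : ℕ} {f : ℝ → ℝ} (hf : Differentiable ℝ f) {x : ℕ → ℝ}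
    (hx : ∀ i < n + 1, x i < x (i + 1)) (hxI : ∀ i ≤ n + 1, x i ∈ Set.Icc a b)
    (hx0 : ∀ i ≤ n + 1, f (x i) = 0) :
    ∃ y : ℕ → ℝ, (∀ i < n, y i < y (i + 1)) ∧ (∀ i ≤ n, y i ∈ Set.Icc a b) ∧
      ∀ i ≤ n, deriv f (y i) = 0 := by
  -- The guard lets `choose` return a sequence on all of ℕ, with arbitrary values past the relevant
  -- indices.
  have h : ∀ i, ∃ y, i < n + 1 → y ∈ Set.Ioo (x i) (x (i + 1)) ∧ deriv f y = 0 := by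
    intro i
    by_cases hi : i < n + 1
    · obtain ⟨y, hy, hy0⟩ := exists_deriv_eq_zero (hx i hi) hf.continuous.continuousOn
        (by rw [hx0 i (by omega), hx0 (i + 1) (by omega)])
      exact ⟨y, fun _ => ⟨hy, hy0⟩⟩
    · exact ⟨0, fun h => absurd h hi⟩
  choose y hy using h
  refine ⟨y, fun i hi => ?_, fun i hi => ?_, fun i hi => (hy i (by omega)).2⟩
  · exact (hy i (by omega)).1.2.trans (hy (i + 1) (by omega)).1.1
  · have h1 := (hy i (by omega)).1
    exact ⟨(hxI i (by omega)).1.trans h1.1.le, h1.2.le.trans (hxI (i + 1) (by omega)).2⟩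

lemma abs_le_of_abs_deriv_le {a b M : ℝ} {f : ℝ → ℝ} (hf : Differentiable ℝ f) {x₀ : ℝ}
    (hx₀ : x₀ ∈ Set.Icc a b) (h0 : f x₀ = 0) (hM : ∀ t ∈ Set.Icc a b, |deriv f t| ≤ M) :
    ∀ t ∈ Set.Icc a b, |f t| ≤ M * (b - a) := by
  intro t ht
  have h := (convex_Icc a b).norm_image_sub_le_of_norm_deriv_le (fun x _ => hf x) hM hx₀ ht
  rw [h0, sub_zero, Real.norm_eq_abs, Real.norm_eq_abs] at h
  have hM0 : 0 ≤ M := (abs_nonneg _).trans (hM t ht)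
  refine h.trans (mul_le_mul_of_nonneg_left ?_ hM0)
  rw [abs_le]
  constructor <;> linarith [hx₀.1, hx₀.2, ht.1, ht.2]

/-- After `n` uses of Rolle the derivative of order `n` has a zero, so its oscillation bounds its
size; each return to a lower derivative costs a factor `b - a`. Oscillation is used because it
ignores polynomials of degree at most `n`. -/
lemma abs_le_of_zeros {a b M : ℝ} (n : ℕ) : ∀ (f : ℝ → ℝ) (x : ℕ → ℝ), ContDiff ℝ n f →
    (∀ i < n, x i < x (i + 1)) → (∀ i ≤ n, x i ∈ Set.Icc a b) → (∀ i ≤ n, f (x i) = 0) →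
    (∀ s ∈ Set.Icc a b, ∀ t ∈ Set.Icc a b, |iteratedDeriv n f s - iteratedDeriv n f t| ≤ M) →
    ∀ t ∈ Set.Icc a b, |f t| ≤ M * (b - a) ^ n := by
  induction n with
  | zero =>
    intro f x _ _ hxI hx0 hM t ht
    have := hM t ht (x 0) (hxI 0 le_rfl)
    simpa [hx0 0 le_rfl] using this
  | succ n ih =>
    intro f x hf hx hxI hx0 hM
    obtain ⟨y, h1, h2, h3⟩ := exists_zeros_deriv (hf.differentiable (by simp)) hx hxI hx0
    have hM' := ih (deriv f) y (ContDiff.deriv' (by exact_mod_cast hf)) h1 h2 h3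
      (by simpa only [iteratedDeriv_succ'] using hM)
    rw [pow_succ, ← mul_assoc]
    exact abs_le_of_abs_deriv_le (hf.differentiable (by simp)) (hxI 0 (by omega))
      (hx0 0 (by omega)) hM'

lemma abs_deriv_le_of_zeros {a b M : ℝ} {n : ℕ} {f : ℝ → ℝ} {x : ℕ → ℝ}
    (hf : ContDiff ℝ (n + 1 : ℕ) f)
    (hx : ∀ i < n + 1, x i < x (i + 1)) (hxI : ∀ i ≤ n + 1, x i ∈ Set.Icc a b)
    (hx0 : ∀ i ≤ n + 1, f (x i) = 0)
    (hM : ∀ s ∈ Set.Icc a b, ∀ t ∈ Set.Icc a b,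
      |iteratedDeriv (n + 1) f s - iteratedDeriv (n + 1) f t| ≤ M) :
    ∀ t ∈ Set.Icc a b, |deriv f t| ≤ M * (b - a) ^ n := by
  obtain ⟨y, h1, h2, h3⟩ := exists_zeros_deriv (hf.differentiable (by simp)) hx hxI hx0
  exact abs_le_of_zeros n (deriv f) y (ContDiff.deriv' (by exact_mod_cast hf)) h1 h2 h3
    (by simpa only [iteratedDeriv_succ'] using hM)

lemma iteratedDeriv_eval_eq (n : ℕ) : ∀ Q : ℝ[X], Q.natDegree ≤ n → ∀ s t : ℝ,
    iteratedDeriv n (fun x => Q.eval x) s = iteratedDeriv n (fun x => Q.eval x) t := by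
  induction n with
  | zero =>
    intro Q hQ s t
    rw [Polynomial.eq_C_of_natDegree_le_zero hQ]
    simp
  | succ n ih =>
    intro Q hQ s t
    have hd : deriv (fun x => Q.eval x) = fun x => (derivative Q).eval x := by
      ext x; exact Q.deriv
    rw [iteratedDeriv_succ', hd]
    exact ih _ ((natDegree_derivative_le Q).trans (by omega)) s t

lemma natDegree_interpolate_le {p : ℕ} {x r : ℕ → ℝ}
    (hx : Set.InjOn x (Finset.range (p + 1))) :
    (Lagrange.interpolate (Finset.range (p + 1)) x r).natDegree ≤ p := by
  have h := Lagrange.degree_interpolate_le (r := r) hx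
  rw [Finset.card_range, Nat.add_sub_cancel] at h
  exact natDegree_le_of_degree_le h

lemma equispaced_lt {a b : ℝ} (hab : a < b) {p : ℕ} (hp : 1 ≤ p) {i j : ℕ} (hij : i < j) :
    a + (i : ℝ) / p * (b - a) < a + (j : ℝ) / p * (b - a) := by
  have hp' : (0 : ℝ) < p := by exact_mod_cast hp
  have h1 : 0 < b - a := sub_pos.2 hab
  have h2 : (i : ℝ) < j := by exact_mod_cast hij
  gcongr

lemma equispaced_injOn {a b : ℝ} (hab : a < b) {p : ℕ} (hp : 1 ≤ p) (s : Set ℕ) :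
    Set.InjOn (fun k : ℕ => a + (k : ℝ) / (p : ℝ) * (b - a)) s :=
  (StrictMono.injective fun _ _ h => equispaced_lt hab hp h).injOn

lemma equispaced_mem {a b : ℝ} (hab : a < b) {p : ℕ} (hp : 1 ≤ p) {i : ℕ} (hi : i ≤ p) :
    a + (i : ℝ) / p * (b - a) ∈ Set.Icc a b := by
  have hp' : (0 : ℝ) < p := by exact_mod_cast hp
  have h1 : 0 < b - a := sub_pos.2 hab
  have h2 : (i : ℝ) / p ≤ 1 := (div_le_one hp').2 (by exact_mod_cast hi)
  constructor
  · have : 0 ≤ (i : ℝ) / p * (b - a) := by positivity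
    linarith
  · nlinarith

/-- `v` agrees with `u` at equally spaced points of `[a, b]`, end points included. -/
lemma IsLagrangeInterpOn.eq_at_node {a b : ℝ} (hab : a < b) {p : ℕ} (hp : 1 ≤ p) {u v : ℝ → ℝ}
    (h : IsLagrangeInterpOn p a b u v) {i : ℕ} (hi : i ≤ p) :
    v (a + (i : ℝ) / p * (b - a)) = u (a + (i : ℝ) / p * (b - a)) := by
  rw [h _ (equispaced_mem hab hp hi)]
  exact Lagrange.eval_interpolate_at_node (fun k : ℕ => u (a + (k : ℝ) / (p : ℝ) * (b - a)))
    (equispaced_injOn hab hp _) (Finset.mem_coe.2 (Finset.mem_range.2 (Nat.lt_succ_of_le hi)))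

lemma IsLagrangeInterpOn.eq_left {a b : ℝ} (hab : a < b) {p : ℕ} (hp : 1 ≤ p) {u v : ℝ → ℝ}
    (h : IsLagrangeInterpOn p a b u v) : v a = u a := by
  simpa using h.eq_at_node hab hp (i := 0) (by omega)

lemma IsLagrangeInterpOn.eq_right {a b : ℝ} (hab : a < b) {p : ℕ} (hp : 1 ≤ p) {u v : ℝ → ℝ}
    (h : IsLagrangeInterpOn p a b u v) : v b = u b := by
  have hp' : (p : ℝ) ≠ 0 := by positivity
  simpa [hp'] using h.eq_at_node hab hp (i := p) le_rfl

lemma exists_contDiff_error {a b : ℝ} (hab : a < b) {p : ℕ} (hp : 1 ≤ p) {u v g : ℝ → ℝ}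
    (hu : ContinuousOn u (Set.Icc a b)) (hg : IntegrableOn g (Set.Ioo a b))
    (H : ∀ φ, IsTest (Set.Ioo a b) φ →
      ∫ x in Set.Ioo a b, u x * iteratedDeriv (p + 1) φ x
        = (-1) ^ (p + 1) * ∫ x in Set.Ioo a b, g x * φ x)
    (hv : IsLagrangeInterpOn p a b u v) :
    ∃ E : ℝ → ℝ, ContDiff ℝ 1 E ∧ Set.EqOn (u - v) E (Set.Icc a b) ∧
      (∀ x ∈ Set.Icc a b, |E x| ≤ (∫ t in Set.Ioo a b, |g t|) * (b - a) ^ p) ∧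
      (∀ x ∈ Set.Icc a b, |deriv E x| ≤ (∫ t in Set.Ioo a b, |g t|) * (b - a) ^ (p - 1)) := by
  obtain ⟨F, hF, hFu, hosc⟩ := exists_contDiff_of_weakDeriv hab hu hg H
  -- This makes the truncated exponent `p - 1` equal to `n`.
  obtain ⟨n, rfl⟩ : ∃ n, p = n + 1 := ⟨p - 1, by omega⟩
  set Q := Lagrange.interpolate (Finset.range (n + 1 + 1))
      (fun k : ℕ => a + (k : ℝ) / ((n + 1 : ℕ) : ℝ) * (b - a))
      (fun k : ℕ => u (a + (k : ℝ) / ((n + 1 : ℕ) : ℝ) * (b - a))) with hQ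
  have hQd : Q.natDegree ≤ n + 1 := natDegree_interpolate_le (equispaced_injOn hab hp _)
  have hQc : ContDiff ℝ (n + 1 : ℕ) (fun x => Q.eval x) := by
    simpa using Q.contDiff_aeval (𝕜 := ℝ) (n + 1 : ℕ)
  have hE : ContDiff ℝ (n + 1 : ℕ) (fun x => F x - Q.eval x) := hF.sub hQc
  have heq : Set.EqOn (u - v) (fun x => F x - Q.eval x) (Set.Icc a b) := fun x hx => by
    simp only [Pi.sub_apply, hFu hx, hv x hx, hQ]
  have h1 : ∀ i < n + 1, a + (i : ℝ) / ((n + 1 : ℕ) : ℝ) * (b - a) <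
      a + ((i + 1 : ℕ) : ℝ) / ((n + 1 : ℕ) : ℝ) * (b - a) :=
    fun i _ => equispaced_lt hab hp (Nat.lt_succ_self i)
  have h2 : ∀ i ≤ n + 1, a + (i : ℝ) / ((n + 1 : ℕ) : ℝ) * (b - a) ∈ Set.Icc a b :=
    fun i hi => equispaced_mem hab hp hi
  have h3 : ∀ i ≤ n + 1, (fun x => F x - Q.eval x)
      (a + (i : ℝ) / ((n + 1 : ℕ) : ℝ) * (b - a)) = 0 := fun i hi => by
    rw [← heq (h2 i hi), Pi.sub_apply, hv.eq_at_node hab hp hi, sub_self]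
  have h4 : ∀ s ∈ Set.Icc a b, ∀ t ∈ Set.Icc a b,
      |iteratedDeriv (n + 1) (fun x => F x - Q.eval x) s -
        iteratedDeriv (n + 1) (fun x => F x - Q.eval x) t| ≤ ∫ t in Set.Ioo a b, |g t| := by
    intro s hs t ht
    rw [iteratedDeriv_fun_sub hF.contDiffAt hQc.contDiffAt,
      iteratedDeriv_fun_sub hF.contDiffAt hQc.contDiffAt,
      iteratedDeriv_eval_eq _ Q hQd s t, sub_sub_sub_cancel_right]
    exact hosc s hs t ht
  exact ⟨_, hE.of_le (by simp), heq, abs_le_of_zeros (n + 1) _ _ hE h1 h2 h3 h4,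
    abs_deriv_le_of_zeros (x := fun i : ℕ => a + (i : ℝ) / ((n + 1 : ℕ) : ℝ) * (b - a))
      hE h1 h2 h3 h4⟩

/-! ### Error estimates that can be glued along adjacent intervals -/

/-- Estimates of `e` and `e'` in `L²(a, b)` by `g`, together with integration by parts for `e`
against functions without boundary condition. -/
structure ErrorBound (K K' : ℝ≥0∞) (g e : ℝ → ℝ) (a b : ℝ) : Prop where
  le : a ≤ b
  continuousOn : ContinuousOn e (Set.Icc a b)
  integrable_deriv : IntervalIntegrable (deriv e) volume a b
  parts : ∀ φ : ℝ → ℝ, ContDiff ℝ ∞ φ →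
    ∫ x in a..b, e x * deriv φ x = - ∫ x in a..b, deriv e x * φ x
  bound : ∫⁻ x in Set.Ioc a b, ‖e x‖ₑ ^ 2 ≤ K * ∫⁻ x in Set.Ioc a b, ‖g x‖ₑ ^ 2
  bound_deriv : ∫⁻ x in Set.Ioc a b, ‖deriv e x‖ₑ ^ 2 ≤ K' * ∫⁻ x in Set.Ioc a b, ‖g x‖ₑ ^ 2

lemma lintegral_Ioc_add {a b c : ℝ} (hab : a ≤ b) (hbc : b ≤ c) (f : ℝ → ℝ≥0∞) :
    ∫⁻ x in Set.Ioc a c, f x = (∫⁻ x in Set.Ioc a b, f x) + ∫⁻ x in Set.Ioc b c, f x := by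
  rw [← Set.Ioc_union_Ioc_eq_Ioc hab hbc, lintegral_union measurableSet_Ioc
    (Set.Ioc_disjoint_Ioc_of_le le_rfl)]

/-- Squared norms are additive over adjacent intervals, so the constants do not grow; a jump of the
derivative at `b` is invisible to the integrals. -/
lemma ErrorBound.trans {K K' : ℝ≥0∞} {g e : ℝ → ℝ} {a b c : ℝ}
    (h : ErrorBound K K' g e a b) (h' : ErrorBound K K' g e b c) : ErrorBound K K' g e a c where
  le := h.le.trans h'.le
  continuousOn := by
    rw [← Set.Icc_union_Icc_eq_Icc h.le h'.le]
    exact h.continuousOn.union_of_isClosed h'.continuousOn isClosed_Icc isClosed_Icc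
  integrable_deriv := h.integrable_deriv.trans h'.integrable_deriv
  parts := fun φ hφ => by
    have hd : Continuous (deriv φ) := hφ.continuous_deriv (by exact_mod_cast le_top)
    have i1 : IntervalIntegrable (fun x => e x * deriv φ x) volume a b :=
      ContinuousOn.intervalIntegrable (by
        rw [Set.uIcc_of_le h.le]; exact h.continuousOn.mul hd.continuousOn)
    have i2 : IntervalIntegrable (fun x => e x * deriv φ x) volume b c :=
      ContinuousOn.intervalIntegrable (by
        rw [Set.uIcc_of_le h'.le]; exact h'.continuousOn.mul hd.continuousOn)
    rw [← intervalIntegral.integral_add_adjacent_intervals i1 i2,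
      ← intervalIntegral.integral_add_adjacent_intervals
        (h.integrable_deriv.mul_continuousOn hφ.continuous.continuousOn)
        (h'.integrable_deriv.mul_continuousOn hφ.continuous.continuousOn),
      h.parts φ hφ, h'.parts φ hφ]
    ring
  bound := by
    rw [lintegral_Ioc_add h.le h'.le, lintegral_Ioc_add h.le h'.le, mul_add]
    exact add_le_add h.bound h'.bound
  bound_deriv := by
    rw [lintegral_Ioc_add h.le h'.le, lintegral_Ioc_add h.le h'.le, mul_add]
    exact add_le_add h.bound_deriv h'.bound_deriv

lemma eLpNorm_two_sq (f : ℝ → ℝ) (μ : Measure ℝ) :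
    eLpNorm f 2 μ ^ 2 = ∫⁻ x, ‖f x‖ₑ ^ 2 ∂μ := by
  have := eLpNorm_nnreal_pow_eq_lintegral (f := f) (μ := μ) (p := 2) (by norm_num)
  simpa using this

lemma sq_integral_abs_le {a b : ℝ} {g : ℝ → ℝ}
    (hg : IntegrableOn g (Set.Ioc a b)) :
    ENNReal.ofReal (∫ t in Set.Ioc a b, |g t|) ^ 2 ≤
      ENNReal.ofReal (b - a) * ∫⁻ x in Set.Ioc a b, ‖g x‖ₑ ^ 2 := by
  have h1 : ENNReal.ofReal (∫ t in Set.Ioc a b, |g t|) =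
      eLpNorm g 1 (volume.restrict (Set.Ioc a b)) := by
    rw [eLpNorm_one_eq_lintegral_enorm, ← ofReal_integral_norm_eq_lintegral_enorm hg]
    simp only [Real.norm_eq_abs]
  have h2 := eLpNorm_le_eLpNorm_mul_rpow_measure_univ (p := 1) (q := 2) (by norm_num)
    hg.aestronglyMeasurable
  rw [h1]
  calc _ ≤ _ := pow_le_pow_left' h2 2
    _ = _ := by
      rw [mul_pow, eLpNorm_two_sq, mul_comm, Measure.restrict_apply_univ, Real.volume_Ioc,
        ← ENNReal.rpow_natCast, ← ENNReal.rpow_mul]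
      norm_num

lemma lintegral_sq_le_of_abs_le {a b M : ℝ} {f : ℝ → ℝ} (hf : ∀ x ∈ Set.Ioo a b, |f x| ≤ M) :
    ∫⁻ x in Set.Ioc a b, ‖f x‖ₑ ^ 2 ≤ ENNReal.ofReal M ^ 2 * ENNReal.ofReal (b - a) := by
  rw [← restrict_Ioo_eq_restrict_Ioc]
  calc _ ≤ ∫⁻ x in Set.Ioo a b, ENNReal.ofReal M ^ 2 := by
        refine setLIntegral_mono' measurableSet_Ioo fun x hx => ?_
        gcongr
        rw [← ofReal_norm]
        exact ENNReal.ofReal_le_ofReal (hf x hx)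
    _ = _ := by rw [setLIntegral_const, Real.volume_Ioo]

/-- The exponent rises from `n` to `n + 1`: Cauchy-Schwarz for `g` and the length of the interval
each contribute half a power. -/
lemma lintegral_sq_le_of_abs_le_mul {a b h : ℝ} (hab : a ≤ b) (hh : b - a ≤ h) {n : ℕ}
    {f g : ℝ → ℝ} (hg : IntegrableOn g (Set.Ioc a b))
    (hf : ∀ x ∈ Set.Ioo a b, |f x| ≤ (∫ t in Set.Ioc a b, |g t|) * (b - a) ^ n) :
    ∫⁻ x in Set.Ioc a b, ‖f x‖ₑ ^ 2 ≤
      ENNReal.ofReal (h ^ (n + 1)) ^ 2 * ∫⁻ x in Set.Ioc a b, ‖g x‖ₑ ^ 2 := by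
  have h0 : 0 ≤ b - a := sub_nonneg.2 hab
  have hM : 0 ≤ ∫ t in Set.Ioc a b, |g t| := integral_nonneg fun _ => abs_nonneg _
  refine (lintegral_sq_le_of_abs_le hf).trans ?_
  set L := ∫⁻ x in Set.Ioc a b, ‖g x‖ₑ ^ 2
  have hL := sq_integral_abs_le hg
  calc _ = ENNReal.ofReal (∫ t in Set.Ioc a b, |g t|) ^ 2 *
        (ENNReal.ofReal ((b - a)) ^ n) ^ 2 * ENNReal.ofReal (b - a) := by
        rw [ENNReal.ofReal_mul hM, ENNReal.ofReal_pow h0, mul_pow]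
    _ ≤ (ENNReal.ofReal (b - a) * L) * (ENNReal.ofReal ((b - a)) ^ n) ^ 2 *
        ENNReal.ofReal (b - a) := by gcongr
    _ = (ENNReal.ofReal (b - a) ^ (n + 1)) ^ 2 * L := by ring
    _ ≤ _ := by
      rw [ENNReal.ofReal_pow (h0.trans hh)]
      gcongr

lemma IsLagrangeInterpOn.errorBound {a b h : ℝ} (hab : a < b) (hh : b - a ≤ h) {p : ℕ}
    (hp : 1 ≤ p) {u v g : ℝ → ℝ}
    (hu : ContinuousOn u (Set.Icc a b)) (hg : IntegrableOn g (Set.Ioo a b))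
    (H : ∀ φ, IsTest (Set.Ioo a b) φ →
      ∫ x in Set.Ioo a b, u x * iteratedDeriv (p + 1) φ x
        = (-1) ^ (p + 1) * ∫ x in Set.Ioo a b, g x * φ x)
    (hv : IsLagrangeInterpOn p a b u v) :
    ErrorBound (ENNReal.ofReal (h ^ (p + 1)) ^ 2) (ENNReal.ofReal (h ^ p) ^ 2) g (u - v) a b := by
  obtain ⟨E, hE, heq, hb, hb'⟩ := exists_contDiff_error hab hp hu hg H hv
  simp only [← integral_Ioc_eq_integral_Ioo] at hb hb'
  have hg' : IntegrableOn g (Set.Ioc a b) := by rwa [integrableOn_Ioc_iff_integrableOn_Ioo]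
  have hder : ∀ x ∈ Set.Ioo a b, deriv (u - v) x = deriv E x := fun x hx =>
    Filter.EventuallyEq.deriv_eq (Filter.eventually_of_mem (Icc_mem_nhds hx.1 hx.2) heq)
  have hE' : Continuous (deriv E) := hE.continuous_deriv le_rfl
  -- Both end points are interpolation points, which removes the boundary terms below.
  have hE0 : E a = 0 ∧ E b = 0 := by
    rw [← heq (Set.left_mem_Icc.2 hab.le), ← heq (Set.right_mem_Icc.2 hab.le), Pi.sub_apply,
      Pi.sub_apply, hv.eq_left hab hp, hv.eq_right hab hp]
    simp
  refine ⟨hab.le, hE.continuous.continuousOn.congr heq, ?_, fun φ hφ => ?_, ?_, ?_⟩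
  · rw [intervalIntegrable_iff_integrableOn_Ioo_of_le hab.le]
    exact (((hE'.intervalIntegrable a b).1).mono_set Set.Ioo_subset_Ioc_self).congr_fun
      (fun x hx => (hder x hx).symm) measurableSet_Ioo
  · have hd : Continuous (deriv φ) := hφ.continuous_deriv (by exact_mod_cast le_top)
    have h1 : ∫ x in a..b, (u - v) x * deriv φ x = ∫ x in a..b, E x * deriv φ x :=
      intervalIntegral.integral_congr fun x hx => by
        rw [Set.uIcc_of_le hab.le] at hx
        simp only [heq hx]
    have h2 : ∫ x in a..b, deriv (u - v) x * φ x = ∫ x in a..b, deriv E x * φ x := by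
      rw [intervalIntegral.integral_of_le hab.le, intervalIntegral.integral_of_le hab.le,
        integral_Ioc_eq_integral_Ioo, integral_Ioc_eq_integral_Ioo]
      refine setIntegral_congr_fun measurableSet_Ioo fun x hx => ?_
      simp only [hder x hx]
    rw [h1, h2, intervalIntegral.integral_mul_deriv_eq_deriv_mul
      (fun x _ => (hE.differentiable one_ne_zero x).hasDerivAt)
      (fun x _ => ((hφ.differentiable (by simp)) x).hasDerivAt)
      (hE'.intervalIntegrable _ _) (hd.intervalIntegrable _ _), hE0.1, hE0.2]
    ring
  · exact lintegral_sq_le_of_abs_le_mul hab.le hh hg' fun x hx => by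
      rw [heq (Set.Ioo_subset_Icc_self hx)]
      exact hb x (Set.Ioo_subset_Icc_self hx)
  · obtain ⟨n, rfl⟩ : ∃ n, p = n + 1 := ⟨p - 1, by omega⟩
    exact lintegral_sq_le_of_abs_le_mul hab.le hh hg' fun x hx => by
      rw [hder x hx]
      exact hb' x (Set.Ioo_subset_Icc_self hx)

/-! ### Restriction of weak derivatives to subintervals -/

lemma tsupport_iteratedDeriv_subset (k : ℕ) (φ : ℝ → ℝ) :
    tsupport (iteratedDeriv k φ) ⊆ tsupport φ := by
  induction k with
  | zero => simp
  | succ k ih =>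
    rw [iteratedDeriv_succ]
    exact tsupport_deriv_subset.trans ih

lemma HasWeakDeriv.restrict {U V : Set ℝ} (hU : MeasurableSet U) (hVU : V ⊆ U) {k : ℕ}
    {u g : ℝ → ℝ} (h : HasWeakDeriv U k u g) {φ : ℝ → ℝ} (hφ : IsTest V φ) :
    ∫ x in V, u x * iteratedDeriv k φ x = (-1) ^ k * ∫ x in V, g x * φ x := by
  have h1 := h.2.2 φ hφ.contDiff hφ.compact (hφ.subset.trans hVU)
  rw [← setIntegral_eq_of_subset_of_forall_sdiff_eq_zero hU hVU,
    ← setIntegral_eq_of_subset_of_forall_sdiff_eq_zero hU hVU, h1]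
  · intro x hx
    rw [hφ.eq_zero hx.2, mul_zero]
  · intro x hx
    rw [image_eq_zero_of_notMem_tsupport fun hx' =>
      hx.2 (hφ.subset (tsupport_iteratedDeriv_subset k φ hx')), mul_zero]

/-- Used to replace a one-sided derivative by the function glued from both sides of the interface.
-/
lemma ErrorBound.congr_right {K K' : ℝ≥0∞} {g g' e : ℝ → ℝ} {a b : ℝ}
    (h : ErrorBound K K' g e a b) (hg : Set.EqOn g g' (Set.Ioo a b)) :
    ErrorBound K K' g' e a b where
  le := h.le
  continuousOn := h.continuousOn
  integrable_deriv := h.integrable_deriv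
  parts := h.parts
  bound := by
    have : ∫⁻ x in Set.Ioc a b, ‖g' x‖ₑ ^ 2 = ∫⁻ x in Set.Ioc a b, ‖g x‖ₑ ^ 2 := by
      rw [← restrict_Ioo_eq_restrict_Ioc]
      exact setLIntegral_congr_fun measurableSet_Ioo fun x hx => by simp only [hg hx]
    rw [this]; exact h.bound
  bound_deriv := by
    have : ∫⁻ x in Set.Ioc a b, ‖g' x‖ₑ ^ 2 = ∫⁻ x in Set.Ioc a b, ‖g x‖ₑ ^ 2 := by
      rw [← restrict_Ioo_eq_restrict_Ioc]
      exact setLIntegral_congr_fun measurableSet_Ioo fun x hx => by simp only [hg hx]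
    rw [this]; exact h.bound_deriv

/-- The interpolation error on a subinterval `(a, b)` of an open set on which `u` has a weak
derivative of order `p + 1` in `L²`. -/
lemma HasWeakDeriv.errorBound {U : Set ℝ} (hU : MeasurableSet U) {a b h : ℝ}
    (hab : a < b) (hh : b - a ≤ h) (habU : Set.Ioo a b ⊆ U) {p : ℕ} (hp : 1 ≤ p)
    {u v g g' : ℝ → ℝ} (hu : ContinuousOn u (Set.Icc a b)) (hw : HasWeakDeriv U (p + 1) u g)
    (hg : MemLp g 2 (volume.restrict U)) (hgg' : Set.EqOn g g' (Set.Ioo a b))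
    (hv : IsLagrangeInterpOn p a b u v) :
    ErrorBound (ENNReal.ofReal (h ^ (p + 1)) ^ 2) (ENNReal.ofReal (h ^ p) ^ 2) g' (u - v) a b := by
  have hg1 : MemLp g 2 (volume.restrict (Set.Ioo a b)) :=
    hg.mono_measure (Measure.restrict_mono habU le_rfl)
  exact (hv.errorBound hab hh hp hu (hg1.integrable (by norm_num))
    (fun φ hφ => hw.restrict hU habU hφ)).congr_right hgg'

/-! ### Bernstein expansions -/

lemma X_pow_mul_one_sub_X_pow_mem_span {p j : ℕ} (hj : j ≤ p) :
    (X ^ j * (1 - X) ^ (p - j) : ℝ[X]) ∈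
      Submodule.span ℝ (Set.range fun k : Fin (p + 1) => bernsteinPolynomial ℝ p k) := by
  have hc : ((p.choose j : ℕ) : ℝ) ≠ 0 := by exact_mod_cast (Nat.choose_pos hj).ne'
  have : (X ^ j * (1 - X) ^ (p - j) : ℝ[X]) =
      ((p.choose j : ℕ) : ℝ)⁻¹ • bernsteinPolynomial ℝ p j := by
    rw [bernsteinPolynomial, mul_assoc, ← nsmul_eq_mul, ← Nat.cast_smul_eq_nsmul ℝ, smul_smul,
      inv_mul_cancel₀ hc, one_smul]
  rw [this]
  exact Submodule.smul_mem _ _ (Submodule.subset_span ⟨⟨j, by omega⟩, rfl⟩)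

/-- Multiply $X^i$ by $1=(X+(1-X))^{p-i}$ and expand. -/
lemma mem_span_bernstein {p : ℕ} {P : ℝ[X]} (hP : P.natDegree ≤ p) :
    P ∈ Submodule.span ℝ (Set.range fun k : Fin (p + 1) => bernsteinPolynomial ℝ p k) := by
  rw [P.as_sum_range_C_mul_X_pow' (Nat.lt_succ_of_le hP)]
  refine Submodule.sum_mem _ fun i hi => ?_
  have hi' : i ≤ p := Nat.lt_succ_iff.1 (Finset.mem_range.1 hi)
  rw [C_mul']
  refine Submodule.smul_mem _ _ ?_
  have h : (X ^ i : ℝ[X]) = ∑ k ∈ Finset.range (p - i + 1),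
      ((p - i).choose k : ℝ) • (X ^ (i + k) * (1 - X) ^ (p - (i + k))) := by
    have h1 : (X ^ i : ℝ[X]) = X ^ i * (X + (1 - X)) ^ (p - i) := by simp
    rw [h1, add_pow, Finset.mul_sum]
    refine Finset.sum_congr rfl fun k _ => ?_
    rw [Nat.cast_smul_eq_nsmul ℝ, nsmul_eq_mul, pow_add, Nat.sub_sub]
    ring
  rw [h]
  refine Submodule.sum_mem _ fun k hk => Submodule.smul_mem _ _ ?_
  have := Finset.mem_range.1 hk
  exact X_pow_mul_one_sub_X_pow_mem_span (by omega)

lemma exists_bernstein_coeff {p : ℕ} {P : ℝ[X]} (hP : P.natDegree ≤ p) {a b : ℝ} (hab : a < b) :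
    ∃ c : ℕ → ℝ, ∀ x, P.eval x = ∑ k ∈ Finset.range (p + 1),
      c k * (bernsteinPolynomial ℝ p k).eval ((x - a) / (b - a)) := by
  have hR : (P.comp (C (b - a) * X + C a)).natDegree ≤ p := by
    refine natDegree_comp_le.trans ?_
    calc P.natDegree * (C (b - a) * X + C a).natDegree ≤ p * 1 :=
          Nat.mul_le_mul hP natDegree_linear_le
      _ = p := mul_one p
  obtain ⟨c, hc⟩ := (Submodule.mem_span_range_iff_exists_fun ℝ).1 (mem_span_bernstein hR)
  refine ⟨fun k => if h : k < p + 1 then c ⟨k, h⟩ else 0, fun x => ?_⟩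
  have hba : b - a ≠ 0 := (sub_pos.2 hab).ne'
  have h1 : P.eval x = (P.comp (C (b - a) * X + C a)).eval ((x - a) / (b - a)) := by
    rw [eval_comp]
    congr 1
    simp only [eval_add, eval_mul, eval_C, eval_X]
    field_simp
    ring
  rw [h1, ← hc, eval_finsetSum, Finset.sum_range]
  refine Finset.sum_congr rfl fun k _ => ?_
  rw [eval_smul, smul_eq_mul]
  simp only [k.2, dif_pos]

namespace Mesh

variable {N : ℕ} (m : Mesh N)

/-! ### Elements of the mesh -/

lemma left_lt_right (l : Fin N) : m.left l < m.right l :=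
  m.strictMono_node Fin.castSucc_lt_succ

lemma right_le_left {l l' : Fin N} (h : l < l') : m.right l ≤ m.left l' :=
  m.strictMono_node.monotone (Fin.succ_le_castSucc_iff.2 h)

lemma left_nonneg (l : Fin N) : 0 ≤ m.left l := by
  rw [← m.node_zero]
  exact m.strictMono_node.monotone (Fin.zero_le _)

lemma right_le_one (l : Fin N) : m.right l ≤ 1 := by
  rw [← m.node_last]
  exact m.strictMono_node.monotone (Fin.le_last _)

lemma length_le_size (l : Fin N) : m.right l - m.left l ≤ m.size :=
  le_ciSup (f := fun l => m.right l - m.left l) (Set.finite_range _).bddAbove l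

lemma right_of_succ_eq {l : Fin N} (h : (l : ℕ) + 1 = N) : m.right l = 1 := by
  rw [← m.node_last, right]
  congr 1
  ext
  simpa using h

lemma left_of_eq_zero {l : Fin N} (h : (l : ℕ) = 0) : m.left l = 0 := by
  rw [← m.node_zero, left]
  congr 1
  ext
  simpa using h

lemma left_eq_right {l l' : Fin N} (h : (l : ℕ) + 1 = l') : m.left l' = m.right l := by
  rw [left, right]
  congr 1
  ext
  simpa using h.symm

/-- A transitive relation that holds on each element holds on `[0, 1]`. -/
lemma of_elements {P : ℝ → ℝ → Prop} (htrans : ∀ a b c, P a b → P b c → P a c)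
    (h : ∀ l, P (m.left l) (m.right l)) : P 0 1 := by
  have key : ∀ i : Fin (N + 1), i ≠ 0 → P (m.node 0) (m.node i) := by
    intro i
    induction i using Fin.induction with
    | zero => exact fun h => absurd rfl h
    | succ i ih =>
      intro _
      by_cases hi : i.castSucc = 0
      · rw [← hi]
        exact h i
      · exact htrans _ _ _ (ih hi) (h i)
  have hN : (Fin.last N : Fin (N + 1)) ≠ 0 := by
    intro h0
    have h1 := m.node_last
    rw [h0, m.node_zero] at h1
    exact zero_ne_one h1
  rw [← m.node_zero, ← m.node_last]
  exact key _ hN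

lemma exists_mem_element {x : ℝ} (hx : x ∈ Set.Icc (0 : ℝ) 1) :
    ∃ l, x ∈ Set.Icc (m.left l) (m.right l) := by
  refine m.of_elements (P := fun a b => x ∈ Set.Icc a b →
    ∃ l, x ∈ Set.Icc (m.left l) (m.right l)) ?_ (fun l hl => ⟨l, hl⟩) hx
  intro a b c h1 h2 hx
  rcases le_total x b with h | h
  · exact h1 ⟨hx.1, h⟩
  · exact h2 ⟨h, hx.2⟩

lemma mem_Ioo_of_notMem_range {γ : ℝ} (hγ : γ ∉ Set.range m.node) {l : Fin N}
    (h : γ ∈ Set.Icc (m.left l) (m.right l)) : γ ∈ Set.Ioo (m.left l) (m.right l) :=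
  ⟨h.1.lt_of_ne fun h' => hγ ⟨_, h'⟩, h.2.lt_of_ne fun h' => hγ ⟨_, h'.symm⟩⟩

lemma element_unique {γ : ℝ} (hγ : γ ∉ Set.range m.node) {l r : Fin N}
    (hl : γ ∈ Set.Icc (m.left l) (m.right l)) (hr : γ ∈ Set.Icc (m.left r) (m.right r)) :
    l = r := by
  have hl' := m.mem_Ioo_of_notMem_range hγ hl
  have hr' := m.mem_Ioo_of_notMem_range hγ hr
  rcases lt_trichotomy l r with h | h | h
  · have := m.right_le_left h
    linarith [hl'.2, hr'.1]
  · exact h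
  · have := m.right_le_left h
    linarith [hl'.1, hr'.2]

lemma eq_of_mem_cell {l l' : Fin N} {x : ℝ} (h : x ∈ m.cell l) (h' : x ∈ m.cell l') :
    l = l' := by
  have key : ∀ {l l' : Fin N}, x ∈ m.cell l → x ∈ m.cell l' → ¬ l < l' := by
    intro l l' h h' hlt
    have h1 := m.right_le_left hlt
    have h2 := h'.1
    rcases h.2 with h3 | h3
    · linarith
    · have := l'.2
      have : (l : ℕ) < l' := hlt
      omega
  exact le_antisymm (not_lt.1 (key h' h)) (not_lt.1 (key h h'))

/-! ### Values of the basis functions on closed elements -/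

lemma bspline_of_mem_cell (p j : ℕ) {l : Fin N} {x : ℝ} (hx : x ∈ m.cell l) :
    m.bspline p j x = if p * (l : ℕ) ≤ j then
      (bernsteinPolynomial ℝ p (j - p * (l : ℕ))).eval
        ((x - m.left l) / (m.right l - m.left l)) else 0 := by
  rw [bspline, Finset.sum_eq_single l, Set.indicator_of_mem hx]
  · intro l' _ hne
    exact Set.indicator_of_notMem (fun h => hne (m.eq_of_mem_cell h hx)) _
  · simp

/-- At a shared node only the last Bernstein polynomial on the left and the first on the right are
nonzero. Both equal one and carry the same index `j`, so the formula survives at the right end. -/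
lemma bspline_of_mem_Icc {p : ℕ} (hp : 1 ≤ p) (j : ℕ) {l : Fin N} {x : ℝ}
    (hx : x ∈ Set.Icc (m.left l) (m.right l)) :
    m.bspline p j x = if p * (l : ℕ) ≤ j then
      (bernsteinPolynomial ℝ p (j - p * (l : ℕ))).eval
        ((x - m.left l) / (m.right l - m.left l)) else 0 := by
  by_cases hc : x ∈ m.cell l
  · exact m.bspline_of_mem_cell p j hc
  · have hxr : x = m.right l := by
      by_contra h
      exact hc ⟨hx.1, Or.inl (lt_of_le_of_ne hx.2 h)⟩
    have hN : (l : ℕ) + 1 ≠ N := fun h => hc ⟨hx.1, Or.inr ⟨h, hxr⟩⟩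
    have hl := l.2
    let l' : Fin N := ⟨(l : ℕ) + 1, by omega⟩
    have hleft : m.left l' = m.right l := m.left_eq_right rfl
    have hx' : x ∈ m.cell l' :=
      ⟨by rw [hleft, hxr], Or.inl (by rw [hxr, ← hleft]; exact m.left_lt_right l')⟩
    have hd : m.right l - m.left l ≠ 0 := (sub_pos.2 (m.left_lt_right l)).ne'
    rw [m.bspline_of_mem_cell p j hx', hleft, hxr, sub_self, zero_div, div_self hd,
      bernsteinPolynomial.eval_at_0, bernsteinPolynomial.eval_at_1]
    have hl' : p * (l' : ℕ) = p * (l : ℕ) + p := by simp only [l']; ring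
    rw [hl']
    split_ifs <;> first | rfl | (exfalso; omega)

lemma linearInterp_of_mem_Icc (g : ℝ → ℝ) {l : Fin N} {x : ℝ}
    (hx : x ∈ Set.Icc (m.left l) (m.right l)) :
    m.linearInterp g x = g (m.left l) * (1 - (x - m.left l) / (m.right l - m.left l)) +
      g (m.right l) * ((x - m.left l) / (m.right l - m.left l)) := by
  simp only [linearInterp, m.bspline_of_mem_Icc le_rfl _ hx, one_mul]
  rw [Fintype.sum_eq_add l.castSucc l.succ Fin.castSucc_lt_succ.ne]
  · simp [bernsteinPolynomial, left, right]
  · rintro i ⟨h1, h2⟩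
    have h1' : (i : ℕ) ≠ l := fun h => h1 (Fin.ext h)
    have h2' : (i : ℕ) ≠ l + 1 := fun h => h2 (Fin.ext (by simpa using h))
    split_ifs with h
    · rw [bernsteinPolynomial.eq_zero_of_lt ℝ (by omega)]
      simp
    · simp

/-- Away from its kink $|x-\gamma|$ is affine, hence reproduced by linear interpolation. -/
lemma enrichment_eq_zero {γ : ℝ} {l : Fin N} (hγ : γ ∉ Set.Icc (m.left l) (m.right l)) {x : ℝ}
    (hx : x ∈ Set.Icc (m.left l) (m.right l)) : m.enrichment γ x = 0 := by
  have hd : m.right l - m.left l ≠ 0 := (sub_pos.2 (m.left_lt_right l)).ne'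
  have hlr := m.left_lt_right l
  rw [enrichment, m.linearInterp_of_mem_Icc _ hx]
  rcases lt_or_ge γ (m.left l) with h | h
  · rw [abs_of_nonneg (by linarith), abs_of_nonneg (by linarith),
      abs_of_nonneg (by linarith [hx.1])]
    field_simp
    ring
  · have h' : m.right l < γ := by
      by_contra h'
      exact hγ ⟨h, not_lt.1 h'⟩
    rw [abs_of_nonpos (by linarith), abs_of_nonpos (by linarith),
      abs_of_nonpos (by linarith [hx.2])]
    field_simp
    ring

/-- The linear polynomial that agrees with the enrichment function between the left end of the
element that contains `γ` and `γ`. -/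
noncomputable def enrichmentLeft (γ : ℝ) (l : Fin N) : ℝ[X] :=
  C (2 * (m.right l - γ) / (m.right l - m.left l)) * (X - C (m.left l))

/-- The linear polynomial that agrees with the enrichment function between `γ` and the right end
of the element that contains `γ`. -/
noncomputable def enrichmentRight (γ : ℝ) (l : Fin N) : ℝ[X] :=
  C (2 * (γ - m.left l) / (m.right l - m.left l)) * (C (m.right l) - X)

lemma enrichment_eq_left {γ : ℝ} {l : Fin N} (hγ : γ ∈ Set.Icc (m.left l) (m.right l)) {x : ℝ}
    (hx : x ∈ Set.Icc (m.left l) γ) : m.enrichment γ x = (m.enrichmentLeft γ l).eval x := by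
  have hd : m.right l - m.left l ≠ 0 := (sub_pos.2 (m.left_lt_right l)).ne'
  rw [enrichment, m.linearInterp_of_mem_Icc _ ⟨hx.1, hx.2.trans hγ.2⟩,
    abs_of_nonpos (by linarith [hγ.1]), abs_of_nonneg (by linarith [hγ.2]),
    abs_of_nonpos (by linarith [hx.2])]
  simp only [enrichmentLeft, eval_mul, eval_C, eval_sub, eval_X]
  field_simp
  ring

lemma enrichment_eq_right {γ : ℝ} {l : Fin N} (hγ : γ ∈ Set.Icc (m.left l) (m.right l)) {x : ℝ}
    (hx : x ∈ Set.Icc γ (m.right l)) : m.enrichment γ x = (m.enrichmentRight γ l).eval x := by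
  have hd : m.right l - m.left l ≠ 0 := (sub_pos.2 (m.left_lt_right l)).ne'
  rw [enrichment, m.linearInterp_of_mem_Icc _ ⟨hγ.1.trans hx.1, hx.2⟩,
    abs_of_nonpos (by linarith [hγ.1]), abs_of_nonneg (by linarith [hγ.2]),
    abs_of_nonneg (by linarith [hx.1])]
  simp only [enrichmentRight, eval_mul, eval_C, eval_sub, eval_X]
  field_simp
  ring

lemma enrichmentLeft_sub_enrichmentRight (γ x : ℝ) (l : Fin N) :
    (m.enrichmentLeft γ l).eval x - (m.enrichmentRight γ l).eval x = 2 * (x - γ) := by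
  have hd : m.right l - m.left l ≠ 0 := (sub_pos.2 (m.left_lt_right l)).ne'
  simp only [enrichmentLeft, enrichmentRight, eval_mul, eval_C, eval_sub, eval_X]
  field_simp
  ring

lemma natDegree_enrichmentLeft_le (γ : ℝ) (l : Fin N) : (m.enrichmentLeft γ l).natDegree ≤ 1 :=
  (natDegree_C_mul_le _ _).trans (natDegree_X_sub_C _).le

/-! ### Continuous piecewise polynomials belong to the finite element space -/

/-- The extreme Bernstein coefficients on an element are its nodal values, so neighbours agree on
the shared coefficient. The coefficients at `0` and `p * N` vanish with `u`, leaving only admissible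
indices. -/
lemma exists_mem_femSpace {p : ℕ} (hp : 1 ≤ p) {P : Fin N → ℝ[X]} {u : ℝ → ℝ}
    (hP : ∀ l, (P l).natDegree ≤ p) (hleft : ∀ l, (P l).eval (m.left l) = u (m.left l))
    (hright : ∀ l, (P l).eval (m.right l) = u (m.right l)) (h0 : u 0 = 0) (h1 : u 1 = 0) :
    ∃ f ∈ m.femSpace p, ∀ l, ∀ x ∈ Set.Icc (m.left l) (m.right l), f x = (P l).eval x := by
  choose c hc using fun l => exists_bernstein_coeff (hP l) (m.left_lt_right l)
  have hcl : ∀ l, c l 0 = u (m.left l) := by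
    intro l
    rw [← hleft, hc, sub_self, zero_div]
    simp [bernsteinPolynomial.eval_at_0]
  have hcr : ∀ l, c l p = u (m.right l) := by
    intro l
    rw [← hright, hc, div_self (sub_pos.2 (m.left_lt_right l)).ne']
    simp [bernsteinPolynomial.eval_at_1]
  -- A node's coefficient is read from the element on its right; the default covers `j = p * N`,
  -- where it must be `0`.
  let D : ℕ → ℝ := fun j => if h : j / p < N then c ⟨j / p, h⟩ (j % p) else 0
  have hDlt : ∀ (l : Fin N) (k : ℕ), k < p → D (p * l + k) = c l k := by
    intro l k hk
    have hdiv : (p * (l : ℕ) + k) / p = l := by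
      rw [Nat.mul_add_div (by omega), Nat.div_eq_of_lt hk, add_zero]
    have hmod : (p * (l : ℕ) + k) % p = k := by
      rw [Nat.mul_add_mod, Nat.mod_eq_of_lt hk]
    simp only [D, hdiv, hmod, l.2, dif_pos]
  have hDN : D (p * N) = 0 := by
    simp only [D, Nat.mul_div_cancel_left N (show 0 < p by omega), lt_irrefl, dif_neg,
      not_false_eq_true]
  have hDp : ∀ l : Fin N, D (p * l + p) = c l p := by
    intro l
    have hl := l.2
    rw [hcr]
    by_cases hN : (l : ℕ) + 1 = N
    · have : p * (l : ℕ) + p = p * N := by rw [← Nat.mul_succ, Nat.succ_eq_add_one, hN]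
      rw [this, hDN, m.right_of_succ_eq hN, h1]
    · let l' : Fin N := ⟨(l : ℕ) + 1, by omega⟩
      have hl' : m.left l' = m.right l := m.left_eq_right rfl
      have : p * (l : ℕ) + p = p * (l' : ℕ) + 0 := by simp only [l']; ring
      rw [this, hDlt l' 0 (by omega), hcl, hl']
  have hD0 : D 0 = 0 := by
    by_cases hN : 0 < N
    · have := hDlt ⟨0, hN⟩ 0 (by omega)
      simp only [mul_zero, add_zero] at this
      rw [this, hcl, m.left_of_eq_zero rfl, h0]
    · have : N = 0 := by omega
      subst this
      simpa using hDN
  refine ⟨∑ j ∈ Finset.Ioo 0 (p * N), D j • m.bspline p j, ?_, fun l x hx => ?_⟩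
  · refine Submodule.sum_mem _ fun j hj => Submodule.smul_mem _ _ (Submodule.subset_span ?_)
    exact ⟨j, (Finset.mem_Ioo.1 hj).1, (Finset.mem_Ioo.1 hj).2, rfl⟩
  · have hN : p * (l : ℕ) + p ≤ p * N := by
      have := Nat.mul_le_mul_left p (Nat.succ_le_of_lt l.2)
      rwa [Nat.mul_succ] at this
    have e1 : ∑ j ∈ Finset.Ioo 0 (p * N), D j * m.bspline p j x =
        ∑ j ∈ Finset.range (p * N + 1), D j * m.bspline p j x := by
      refine Finset.sum_subset (fun j hj => ?_) fun j hj hj' => ?_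
      · have := Finset.mem_Ioo.1 hj
        exact Finset.mem_range.2 (by omega)
      · have h2 : j = 0 ∨ j = p * N := by
          rw [Finset.mem_range] at hj
          rw [Finset.mem_Ioo] at hj'
          omega
        rcases h2 with rfl | rfl
        · rw [hD0, zero_mul]
        · rw [hDN, zero_mul]
    have e2 : ∑ j ∈ Finset.Ico (p * (l : ℕ)) (p * l + (p + 1)), D j * m.bspline p j x =
        ∑ j ∈ Finset.range (p * N + 1), D j * m.bspline p j x := by
      refine Finset.sum_subset (fun j hj => ?_) fun j _ hj' => ?_
      · have := Finset.mem_Ico.1 hj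
        exact Finset.mem_range.2 (by omega)
      · rw [m.bspline_of_mem_Icc hp j hx]
        rw [Finset.mem_Ico] at hj'
        split_ifs with h
        · rw [bernsteinPolynomial.eq_zero_of_lt ℝ (by omega)]
          simp
        · simp
    simp only [Finset.sum_apply, Pi.smul_apply, smul_eq_mul]
    rw [e1, ← e2, Finset.sum_Ico_eq_sum_range, Nat.add_sub_cancel_left, hc]
    refine Finset.sum_congr rfl fun k hk => ?_
    rw [m.bspline_of_mem_Icc hp _ hx, if_pos (Nat.le_add_right _ _), Nat.add_sub_cancel_left]
    rcases (Nat.lt_succ_iff.1 (Finset.mem_range.1 hk)).lt_or_eq with h | rfl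
    · rw [hDlt l k h]
    · rw [hDp l]

/-- On the element that contains `γ`, the enrichment space contains all products of the enrichment
function with polynomials of degree at most `p`. -/
lemma exists_mem_enrSpace {p : ℕ} (hp : 1 ≤ p) {γ : ℝ} (hγ : γ ∉ Set.range m.node) {r : Fin N}
    (hr : γ ∈ Set.Icc (m.left r) (m.right r)) {Q : ℝ[X]} (hQ : Q.natDegree ≤ p) :
    ∃ f ∈ m.enrSpace p γ,
      (∀ x ∈ Set.Icc (m.left r) (m.right r), f x = m.enrichment γ x * Q.eval x) ∧
      ∀ l, l ≠ r → ∀ x ∈ Set.Icc (m.left l) (m.right l), f x = 0 := by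
  obtain ⟨d, hd⟩ := exists_bernstein_coeff hQ (m.left_lt_right r)
  refine ⟨∑ k ∈ Finset.range (p + 1),
    d k • fun x => m.enrichment γ x * m.bspline p (p * (r : ℕ) + k) x, ?_, fun x hx => ?_,
    fun l hl x hx => ?_⟩
  · refine Submodule.sum_mem _ fun k hk => Submodule.smul_mem _ _ (Submodule.subset_span ?_)
    have := Finset.mem_range.1 hk
    exact ⟨_, ⟨r, hr, by omega, by omega⟩, rfl⟩
  · simp only [Finset.sum_apply, Pi.smul_apply, smul_eq_mul]
    rw [hd, Finset.mul_sum]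
    refine Finset.sum_congr rfl fun k _ => ?_
    rw [m.bspline_of_mem_Icc hp _ hx, if_pos (Nat.le_add_right _ _), Nat.add_sub_cancel_left]
    ring
  · have : m.enrichment γ x = 0 :=
      m.enrichment_eq_zero (fun h => hl (m.element_unique hγ h hr)) hx
    simp [this]

lemma exists_interfaceInterp {p : ℕ} (hp : 1 ≤ p) {γ : ℝ} (hγ01 : γ ∈ Set.Icc (0 : ℝ) 1)
    (hγ : γ ∉ Set.range m.node) {u : ℝ → ℝ} (h0 : u 0 = 0) (h1 : u 1 = 0) :
    ∃ v ∈ m.sgfemSpace p γ, IsInterfaceInterp m p γ u v := by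
  obtain ⟨r, hr⟩ := m.exists_mem_element hγ01
  have hr' := m.mem_Ioo_of_notMem_range hγ hr
  let I : ℝ → ℝ → ℝ[X] := fun a b => Lagrange.interpolate (Finset.range (p + 1))
      (fun k : ℕ => a + (k : ℝ) / (p : ℝ) * (b - a))
      (fun k : ℕ => u (a + (k : ℝ) / (p : ℝ) * (b - a)))
  have hI : ∀ a b, IsLagrangeInterpOn p a b u (fun x => (I a b).eval x) := fun a b x _ => rfl
  have hId : ∀ {a b}, a < b → (I a b).natDegree ≤ p := fun hab =>
    natDegree_interpolate_le (equispaced_injOn hab hp _)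
  have hIl : ∀ {a b}, a < b → (I a b).eval a = u a := fun hab => (hI _ _).eq_left hab hp
  have hIr : ∀ {a b}, a < b → (I a b).eval b = u b := fun hab => (hI _ _).eq_right hab hp
  set V₀ := I (m.left r) γ
  set V₁ := I γ (m.right r)
  have hroot : (V₀ - V₁).IsRoot γ := by
    simp [V₀, V₁, hIr hr'.1, hIl hr'.2]
  obtain ⟨q, hq⟩ := dvd_iff_isRoot.2 hroot
  have hqd : q.natDegree ≤ p - 1 := by
    by_cases hq0 : q = 0
    · simp [hq0]
    · have h2 : (V₀ - V₁).natDegree ≤ p :=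
        (natDegree_sub_le _ _).trans (max_le (hId hr'.1) (hId hr'.2))
      rw [hq, natDegree_mul (X_sub_C_ne_zero γ) hq0, natDegree_X_sub_C] at h2
      omega
  have hqx : ∀ x, V₀.eval x - V₁.eval x = (x - γ) * q.eval x := fun x => by
    rw [← eval_sub, hq]
    simp
  -- The half cancels the slope jump 2 in `enrichmentLeft_sub_enrichmentRight`.
  let Q : ℝ[X] := C (1 / 2) * q
  have hQd : Q.natDegree ≤ p - 1 := (natDegree_C_mul_le _ _).trans hqd
  have hQx : ∀ x, Q.eval x = q.eval x / 2 := fun x => by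
    simp only [Q, eval_mul, eval_C]
    ring
  let R : ℝ[X] := V₀ - m.enrichmentLeft γ r * Q
  have hRd : R.natDegree ≤ p := by
    refine (natDegree_sub_le _ _).trans (max_le (hId hr'.1) (natDegree_mul_le.trans ?_))
    have := m.natDegree_enrichmentLeft_le γ r
    omega
  have hR₀ : ∀ x, R.eval x = V₀.eval x - (m.enrichmentLeft γ r).eval x * Q.eval x := fun x => by
    simp only [R, eval_sub, eval_mul]
  have hR₁ : ∀ x, R.eval x = V₁.eval x - (m.enrichmentRight γ r).eval x * Q.eval x := fun x => by
    have h2 := m.enrichmentLeft_sub_enrichmentRight γ x r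
    rw [hR₀]
    linear_combination hqx x - Q.eval x * h2 - 2 * (x - γ) * hQx x
  let P : Fin N → ℝ[X] := fun l => if l = r then R else I (m.left l) (m.right l)
  have hPr : P r = R := if_pos rfl
  have hPl : ∀ {l}, l ≠ r → P l = I (m.left l) (m.right l) := fun h => if_neg h
  obtain ⟨f, hf, hfx⟩ := m.exists_mem_femSpace hp (P := P) (u := u)
    (fun l => by
      by_cases h : l = r
      · rw [h, hPr]; exact hRd
      · rw [hPl h]; exact hId (m.left_lt_right l))
    -- The enrichment branches vanish at the outer ends of the element, so `R` keeps the values of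
    -- `u` there.
    (fun l => by
      by_cases h : l = r
      · rw [h, hPr, hR₀, hIl hr'.1]
        simp [enrichmentLeft]
      · rw [hPl h]; exact hIl (m.left_lt_right l))
    (fun l => by
      by_cases h : l = r
      · rw [h, hPr, hR₁, hIr hr'.2]
        simp [enrichmentRight]
      · rw [hPl h]; exact hIr (m.left_lt_right l)) h0 h1
  obtain ⟨e, he, her, hel⟩ := m.exists_mem_enrSpace hp hγ hr (hQd.trans (Nat.sub_le p 1))
  refine ⟨f + e, Submodule.add_mem_sup hf he, fun l => ⟨fun hl x hx => ?_, fun hl => ?_⟩⟩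
  · have hlr : l ≠ r := fun h => hl (h ▸ hr)
    rw [Pi.add_apply, hfx l x hx, hel l hlr x hx, hPl hlr, add_zero]
  · obtain rfl := m.element_unique hγ hl hr
    constructor
    · intro x hx
      have hx' : x ∈ Set.Icc (m.left l) (m.right l) := ⟨hx.1, hx.2.trans hr.2⟩
      rw [Pi.add_apply, hfx l x hx', her x hx', hPr, hR₀, m.enrichment_eq_left hr hx,
        sub_add_cancel]
    · intro x hx
      have hx' : x ∈ Set.Icc (m.left l) (m.right l) := ⟨hr.1.trans hx.1, hx.2⟩
      rw [Pi.add_apply, hfx l x hx', her x hx', hPr, hR₁, m.enrichment_eq_right hr hx,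
        sub_add_cancel]

end Mesh

/-! ### Global estimates -/

lemma eLpNorm_le_of_lintegral_sq_le {f : ℝ → ℝ} {K A B : ℝ≥0∞} {μ : Measure ℝ}
    (h : ∫⁻ x, ‖f x‖ₑ ^ 2 ∂μ ≤ K ^ 2 * (A ^ 2 + B ^ 2)) : eLpNorm f 2 μ ≤ K * (A + B) := by
  rw [← eLpNorm_two_sq] at h
  refine (ENNReal.pow_le_pow_left_iff two_ne_zero).1 (h.trans ?_)
  rw [mul_pow]
  gcongr
  rw [add_sq]
  gcongr
  exact le_self_add

lemma ErrorBound.hasWeakDeriv {K K' : ℝ≥0∞} {g e : ℝ → ℝ} {a b : ℝ}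
    (h : ErrorBound K K' g e a b) : HasWeakDeriv (Set.Ioo a b) 1 e (deriv e) := by
  refine ⟨(h.continuousOn.mono Set.Ioo_subset_Icc_self).locallyIntegrableOn measurableSet_Ioo,
    ((intervalIntegrable_iff_integrableOn_Ioo_of_le h.le).1 h.integrable_deriv).locallyIntegrableOn,
    fun φ hφ _ _ => ?_⟩
  have := h.parts φ hφ
  rw [intervalIntegral.integral_of_le h.le, intervalIntegral.integral_of_le h.le,
    integral_Ioc_eq_integral_Ioo, integral_Ioc_eq_integral_Ioo] at this
  simpa using this

/-- Once the interface element is cut at `γ`, every piece lies on one side and is no longer than the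
mesh size; the local bounds are chained from `0` to `1`. -/
lemma IsInterfaceInterp.errorBound {p : ℕ} (hp : 1 ≤ p) {γ : ℝ} (hγ01 : γ ∈ Set.Ioo (0 : ℝ) 1)
    {N : ℕ} {m : Mesh N} (hγ : γ ∉ Set.range m.node) {u v : ℝ → ℝ}
    (hu : ContinuousOn u (Set.Icc 0 1)) (hv : IsInterfaceInterp m p γ u v) {g₀ g₁ : ℝ → ℝ}
    (hw₀ : HasWeakDeriv (Set.Ioo 0 γ) (p + 1) u g₀)
    (hw₁ : HasWeakDeriv (Set.Ioo γ 1) (p + 1) u g₁)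
    (hg₀ : MemLp g₀ 2 (volume.restrict (Set.Ioo 0 γ)))
    (hg₁ : MemLp g₁ 2 (volume.restrict (Set.Ioo γ 1))) :
    ErrorBound (ENNReal.ofReal (m.size ^ (p + 1)) ^ 2) (ENNReal.ofReal (m.size ^ p) ^ 2)
      (fun x => if x < γ then g₀ x else g₁ x) (u - v) 0 1 := by
  have hu' : ∀ {a b}, 0 ≤ a → b ≤ 1 → ContinuousOn u (Set.Icc a b) := fun ha hb =>
    hu.mono (Set.Icc_subset_Icc ha hb)
  have hL : ∀ {a b}, 0 ≤ a → a < b → b ≤ γ → b - a ≤ m.size → IsLagrangeInterpOn p a b u v →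
      ErrorBound (ENNReal.ofReal (m.size ^ (p + 1)) ^ 2) (ENNReal.ofReal (m.size ^ p) ^ 2)
      (fun x => if x < γ then g₀ x else g₁ x) (u - v) a b := fun ha hab hb hh hi =>
    hw₀.errorBound measurableSet_Ioo hab hh (Set.Ioo_subset_Ioo ha hb) hp
      (hu' ha (hb.trans hγ01.2.le)) hg₀ (fun x hx => (if_pos (hx.2.trans_le hb)).symm) hi
  have hR : ∀ {a b}, γ ≤ a → a < b → b ≤ 1 → b - a ≤ m.size → IsLagrangeInterpOn p a b u v →
      ErrorBound (ENNReal.ofReal (m.size ^ (p + 1)) ^ 2) (ENNReal.ofReal (m.size ^ p) ^ 2)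
      (fun x => if x < γ then g₀ x else g₁ x) (u - v) a b := fun ha hab hb hh hi =>
    hw₁.errorBound measurableSet_Ioo hab hh (Set.Ioo_subset_Ioo ha hb) hp
      (hu' (hγ01.1.le.trans ha) hb) hg₁
      (fun x hx => (if_neg (not_lt.2 (ha.trans hx.1.le))).symm) hi
  refine m.of_elements (fun _ _ _ h h' => h.trans h') fun l => ?_
  have hlr := m.left_lt_right l
  have h0 := m.left_nonneg l
  have h1 := m.right_le_one l
  have hh := m.length_le_size l
  by_cases hl : γ ∈ Set.Icc (m.left l) (m.right l)
  · have hl' := m.mem_Ioo_of_notMem_range hγ hl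
    have hi := (hv l).2 hl
    exact (hL h0 hl'.1 le_rfl (by linarith [hl'.2]) hi.1).trans
      (hR le_rfl hl'.2 h1 (by linarith [hl'.1]) hi.2)
  · have hi := (hv l).1 hl
    rcases lt_or_ge γ (m.left l) with h | h
    · exact hR h.le hlr h1 hh hi
    · exact hL h0 hlr (not_lt.1 fun h' => hl ⟨h, h'.le⟩) hh hi

lemma lintegral_ite_sq {γ : ℝ} (hγ : γ ∈ Set.Ioo (0 : ℝ) 1) (g₀ g₁ : ℝ → ℝ) :
    ∫⁻ x in Set.Ioc 0 1, ‖if x < γ then g₀ x else g₁ x‖ₑ ^ 2 =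
      eLpNorm g₀ 2 (volume.restrict (Set.Ioo 0 γ)) ^ 2 +
        eLpNorm g₁ 2 (volume.restrict (Set.Ioo γ 1)) ^ 2 := by
  rw [lintegral_Ioc_add hγ.1.le hγ.2.le, eLpNorm_two_sq, eLpNorm_two_sq,
    ← restrict_Ioo_eq_restrict_Ioc, ← restrict_Ioo_eq_restrict_Ioc]
  congr 1
  · refine setLIntegral_congr_fun measurableSet_Ioo fun x hx => ?_
    simp only [if_pos hx.2]
  · refine setLIntegral_congr_fun measurableSet_Ioo fun x hx => ?_
    simp only [if_neg (not_lt.2 hx.1.le)]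

/-- A bound by the sum of the norms of all weak derivatives is a bound by the seminorms. -/
lemma le_mul_hSeminorm_add {k : ℕ} {U V : Set ℝ} {u : ℝ → ℝ} {X K : ℝ≥0∞} (hK0 : K ≠ 0)
    (hK : K ≠ ⊤)
    (h : ∀ g₀ g₁, HasWeakDeriv U k u g₀ → HasWeakDeriv V k u g₁ →
      MemLp g₀ 2 (volume.restrict U) → MemLp g₁ 2 (volume.restrict V) →
      X ≤ K * (eLpNorm g₀ 2 (volume.restrict U) + eLpNorm g₁ 2 (volume.restrict V))) :
    X ≤ K * (hSeminorm k U u + hSeminorm k V u) := by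
  have h' : ∀ g₀ g₁, HasWeakDeriv U k u g₀ → HasWeakDeriv V k u g₁ →
      X / K ≤ eLpNorm g₀ 2 (volume.restrict U) + eLpNorm g₁ 2 (volume.restrict V) := by
    intro g₀ g₁ h₀ h₁
    by_cases t₀ : eLpNorm g₀ 2 (volume.restrict U) = ⊤
    · simp [t₀]
    by_cases t₁ : eLpNorm g₁ 2 (volume.restrict V) = ⊤
    · simp [t₁]
    rw [ENNReal.div_le_iff_le_mul (Or.inl hK0) (Or.inl hK), mul_comm]
    exact h g₀ g₁ h₀ h₁ ⟨h₀.2.1.aestronglyMeasurable, lt_top_iff_ne_top.2 t₀⟩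
      ⟨h₁.2.1.aestronglyMeasurable, lt_top_iff_ne_top.2 t₁⟩
  -- The infima are reached one at a time, the other summand being moved across by truncated
  -- subtraction.
  rw [mul_comm, ← ENNReal.div_le_iff_le_mul (Or.inl hK0) (Or.inl hK), ← tsub_le_iff_right]
  refine le_iInf₂ fun g₀ h₀ => ?_
  rw [tsub_le_iff_right, ← tsub_le_iff_left]
  refine le_iInf₂ fun g₁ h₁ => ?_
  rw [tsub_le_iff_left]
  exact h' g₀ g₁ h₀ h₁

lemma Mesh.size_pos {N : ℕ} (m : Mesh N) : 0 < m.size := by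
  obtain ⟨l, -⟩ := m.exists_mem_element (x := 0) ⟨le_rfl, zero_le_one⟩
  exact (sub_pos.2 (m.left_lt_right l)).trans_le (m.length_le_size l)

end SGFEM

theorem lemma4p2 (p : ℕ) (hp : 1 ≤ p) :
    ∃ C : ℝ, 0 < C ∧
      ∀ (γ : ℝ), γ ∈ Set.Ioo (0 : ℝ) 1 →
      ∀ (N : ℕ) (m : SGFEM.Mesh N), γ ∉ Set.range m.node →
      ∀ u : ℝ → ℝ, ContinuousOn u (Set.Icc 0 1) → u 0 = 0 → u 1 = 0 →
        SGFEM.MemH (p + 1) (Set.Ioo 0 γ) u →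
        SGFEM.MemH (p + 1) (Set.Ioo γ 1) u →
        ∃ v ∈ m.sgfemSpace p γ,
          SGFEM.IsInterfaceInterp m p γ u v ∧
          eLpNorm (u - v) 2 (volume.restrict (Set.Ioo 0 1)) ≤
            ENNReal.ofReal (C * m.size ^ (p + 1)) *
              (SGFEM.hSeminorm (p + 1) (Set.Ioo 0 γ) u +
                SGFEM.hSeminorm (p + 1) (Set.Ioo γ 1) u) ∧
          SGFEM.hSeminorm 1 (Set.Ioo 0 1) (u - v) ≤
            ENNReal.ofReal (C * m.size ^ p) *
              (SGFEM.hSeminorm (p + 1) (Set.Ioo 0 γ) u +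
                SGFEM.hSeminorm (p + 1) (Set.Ioo γ 1) u) := by
  refine ⟨1, one_pos, fun γ hγ01 N m hγ u hu h0 h1 _ _ => ?_⟩
  obtain ⟨v, hv, hi⟩ := m.exists_interfaceInterp hp (Set.Ioo_subset_Icc_self hγ01) hγ h0 h1
  have hpos : ∀ n : ℕ, ENNReal.ofReal (m.size ^ n) ≠ 0 := fun n =>
    (ENNReal.ofReal_pos.2 (pow_pos m.size_pos n)).ne'
  refine ⟨v, hv, hi, ?_, ?_⟩
  · rw [one_mul]
    refine SGFEM.le_mul_hSeminorm_add (hpos _) ENNReal.ofReal_ne_top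
      fun g₀ g₁ h₀ h₁ l₀ l₁ => ?_
    have hb := (hi.errorBound hp hγ01 hγ hu h₀ h₁ l₀ l₁).bound
    rw [SGFEM.lintegral_ite_sq hγ01, ← restrict_Ioo_eq_restrict_Ioc] at hb
    exact SGFEM.eLpNorm_le_of_lintegral_sq_le hb
  · rw [one_mul]
    refine SGFEM.le_mul_hSeminorm_add (hpos _) ENNReal.ofReal_ne_top
      fun g₀ g₁ h₀ h₁ l₀ l₁ => ?_
    have hE := hi.errorBound hp hγ01 hγ hu h₀ h₁ l₀ l₁
    have hb := hE.bound_deriv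
    rw [SGFEM.lintegral_ite_sq hγ01, ← restrict_Ioo_eq_restrict_Ioc] at hb
    -- The pointwise derivative of the error is a weak derivative across all nodes and `γ`, so it
    -- bounds the infimum.
    exact (iInf₂_le _ hE.hasWeakDeriv).trans (SGFEM.eLpNorm_le_of_lintegral_sq_le hb)
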